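/- Let $\mathsf{FI}$ be the category of finite sets and injections. An $\mathsf{FI}$-module is a functor $M\colon \mathsf{FI}\to\mathsf{Ab}$ and an $\mathsf{FI}^{\mathrm{op}}$-module is a functor $N\colon \mathsf{FI}^{\mathrm{op}}\to\mathsf{Ab}$. Write $[n]=\{1,\dots,n\}$, $M_n=M([n])$, $N_n=N([n])$. The tensor product $M\otimes_{\mathsf{FI}}N$ is the quotient of the abelian group $\bigoplus_{n\ge 0} M_n\otimes_{\mathbb Z}N_n$ by the subgroup generated by all elements $M(f)(m)\otimes x-m\otimes N(f)(x)$, where $f\colon[a]\to[b]$ is an injection, $m\in M_a$ and $x\in N_b$. An $\mathsf{FI}^{\mathrm{op}}$-module $N$ is called flat if the functor $M\mapsto M\otimes_{\mathsf{FI}}N$ from $\mathsf{FI}$-modules to abelian groups is exact, i.e. takes short exact sequences to short exact sequences. For $\ell\in\mathbb N=\{0,1,2,\dots\}$ and a finite set $S$, let $X_S=\mathrm{Emb}(S,[\ell]\sqcup\mathbb R)$ be the space of injective maps $S\to[\ell]\sqcup\mathbb R$ (with the topology induced from the product $([\ell]\sqcup\mathbb R)^S$), and let $A_S\subseteq X_S$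 be the subspace of those $\phi$ with $[\ell]\not\subseteq\operatorname{im}\phi$. Let $\Xi(\ell)$ be the $\mathsf{FI}^{\mathrm{op}}$-module $\Xi(\ell)_S=H_0(X_S,A_S;\mathbb Z)$ (relative singular homology), on which injections act by precomposition. **Proposition.** For every $\ell\in\mathbb N$, the $\mathsf{FI}^{\mathrm{op}}$-module $\Xi(\ell)$ is flat; that is, the functor $M\mapsto M\otimes_{\mathsf{FI}}\Xi(\ell)$ is exact. -/

import Mathlib

open CategoryTheory Limits
open scoped TensorProduct DirectSum

universe u

/-! ### The category of finite sets and injections -/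

/-- Objects of the category `FI`: finite sets. -/
structure FI : Type 1 where
  /-- the underlying set -/
  carrier : Type
  /-- the underlying set is finite -/
  finite : Finite carrier

namespace FI

instance : CoeSort FI Type := ⟨FI.carrier⟩

/-- Morphisms of `FI` are injections. -/
instance : Category.{0} FI where
  Hom S T := S.carrier ↪ T.carrier
  id S := Function.Embedding.refl S.carrier
  comp f g := Function.Embedding.trans f g

/-- The finite set `[n]`. These sets form a skeleton of `FI`. -/
def std (n : ℕ) : FI := ⟨Fin n, inferInstance⟩

end FI

/-- `FI`-modules: functors from `FI` to abelian groups. -/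
abbrev FIMod := FI ⥤ AddCommGrpCat.{u}

/-- `FI^op`-modules: functors from `FI^op` to abelian groups. -/
abbrev FIopMod := FIᵒᵖ ⥤ AddCommGrpCat.{0}

noncomputable section

/-! ### The functor tensor product over `FI` -/

namespace FI

/-- The group `⨁ₙ Mₙ ⊗ Nₙ`. -/
abbrev TensorSum (M : FIMod.{u}) (N : FIopMod) : Type u :=
  ⨁ n : ℕ, (M.obj (std n) ⊗[ℤ] N.obj (Opposite.op (std n)))

/-- The element `m ⊗ x` of the `n`-th summand of `⨁ₙ Mₙ ⊗ Nₙ`. -/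
def pureTensor (M : FIMod.{u}) (N : FIopMod) (n : ℕ) (m : M.obj (std n))
    (x : N.obj (Opposite.op (std n))) : TensorSum M N :=
  DirectSum.of (fun n => M.obj (std n) ⊗[ℤ] N.obj (Opposite.op (std n))) n (m ⊗ₜ[ℤ] x)

/-- The subgroup generated by the elements `m f ⊗ x - m ⊗ f x`, where `f : [a] → [b]` is an
injection, `m ∈ M_a` and `x ∈ N_b`. -/
def tensorRel (M : FIMod.{u}) (N : FIopMod) : AddSubgroup (TensorSum M N) :=
  AddSubgroup.closure {z | ∃ (a b : ℕ) (f : std a ⟶ std b) (m : M.obj (std a))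
    (x : N.obj (Opposite.op (std b))),
    z = pureTensor M N b (M.map f m) x - pureTensor M N a m (N.map f.op x)}

/-- The functor tensor product `M ⊗_FI N`. -/
abbrev Tensor (M : FIMod.{u}) (N : FIopMod) : Type u := TensorSum M N ⧸ tensorRel M N

/-- The class of `m ⊗ x` in `M ⊗_FI N`. -/
def tmk (M : FIMod.{u}) (N : FIopMod) (n : ℕ) (m : M.obj (std n))
    (x : N.obj (Opposite.op (std n))) : Tensor M N :=
  QuotientAddGroup.mk' (tensorRel M N) (pureTensor M N n m x)

/-- The map `⨁ₙ Mₙ ⊗ Nₙ → ⨁ₙ M'ₙ ⊗ Nₙ` induced by a map `M → M'`. -/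
def tensorSumMap {M M' : FIMod.{u}} (φ : M ⟶ M') (N : FIopMod) :
    TensorSum M N →+ TensorSum M' N :=
  DirectSum.map fun n =>
    (LinearMap.rTensor (N.obj (Opposite.op (std n)))
      (φ.app (std n)).hom.toIntLinearMap).toAddMonoidHom

theorem tensorSumMap_pureTensor {M M' : FIMod.{u}} (φ : M ⟶ M') (N : FIopMod) (n : ℕ)
    (m : M.obj (std n)) (x : N.obj (Opposite.op (std n))) :
    tensorSumMap φ N (pureTensor M N n m x) = pureTensor M' N n (φ.app (std n) m) x := by
  rw [tensorSumMap, pureTensor, DirectSum.map_of]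
  rfl

theorem tensorSumMap_mem {M M' : FIMod.{u}} (φ : M ⟶ M') (N : FIopMod) :
    tensorRel M N ≤ (tensorRel M' N).comap (tensorSumMap φ N) := by
  refine (AddSubgroup.closure_le _).2 ?_
  rintro _ ⟨a, b, f, m, x, rfl⟩
  refine AddSubgroup.subset_closure ⟨a, b, f, φ.app (std a) m, x, ?_⟩
  rw [map_sub, tensorSumMap_pureTensor, tensorSumMap_pureTensor]
  rw [NatTrans.naturality_apply]

/-- The map `M ⊗_FI N → M' ⊗_FI N` induced by a map `M → M'`. -/
def tensorMap {M M' : FIMod.{u}} (φ : M ⟶ M') (N : FIopMod) :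
    Tensor M N →+ Tensor M' N :=
  QuotientAddGroup.map _ _ (tensorSumMap φ N) (tensorSumMap_mem φ N)

theorem tensorMap_tmk {M M' : FIMod.{u}} (φ : M ⟶ M') (N : FIopMod) (n : ℕ)
    (m : M.obj (std n)) (x : N.obj (Opposite.op (std n))) :
    tensorMap φ N (tmk M N n m x) = tmk M' N n (φ.app (std n) m) x := by
  rw [tmk, tmk, ← tensorSumMap_pureTensor]
  rfl

/-- Homomorphisms out of `M ⊗_FI N` are determined by their values on the classes of `m ⊗ x`. -/
theorem tensor_hom_ext {M : FIMod.{u}} {N : FIopMod} {A : Type*} [AddCommGroup A]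
    {g h : Tensor M N →+ A}
    (H : ∀ n (m : M.obj (std n)) (x : N.obj (Opposite.op (std n))),
      g (tmk M N n m x) = h (tmk M N n m x)) : g = h := by
  refine QuotientAddGroup.addMonoidHom_ext _ (DirectSum.addHom_ext' fun n => ?_)
  ext t
  induction t using TensorProduct.induction_on with
  | zero => rw [map_zero, map_zero]
  | tmul m x => exact H n m x
  | add s t hs ht => rw [map_add, map_add, hs, ht]

/-- The functor `M ↦ M ⊗_FI N` from `FI`-modules to abelian groups. -/
def tensorFunctor (N : FIopMod) : FIMod.{u} ⥤ AddCommGrpCat.{u} where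
  obj M := AddCommGrpCat.of (Tensor M N)
  map φ := AddCommGrpCat.ofHom (tensorMap φ N)
  map_id M := by
    have : tensorMap (𝟙 M) N = AddMonoidHom.id _ := tensor_hom_ext fun n m x => by
      rw [tensorMap_tmk]; rfl
    rw [this]; rfl
  map_comp φ ψ := by
    have : tensorMap (φ ≫ ψ) N = (tensorMap ψ N).comp (tensorMap φ N) :=
      tensor_hom_ext fun n m x => by
        rw [AddMonoidHom.comp_apply, tensorMap_tmk, tensorMap_tmk, tensorMap_tmk]; rfl
    rw [this]; rfl

instance (N : FIopMod) : (tensorFunctor.{u} N).PreservesZeroMorphisms where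
  map_zero M M' := by
    have : tensorMap (0 : M ⟶ M') N = 0 := tensor_hom_ext fun n m x => by
      rw [tensorMap_tmk]
      have h : (0 : M ⟶ M').app (std n) m = 0 := rfl
      rw [h, tmk, pureTensor, TensorProduct.zero_tmul, map_zero, map_zero]; rfl
    change AddCommGrpCat.ofHom (tensorMap (0 : M ⟶ M') N) = 0
    rw [this]; rfl

/-- An `FI^op`-module `N` is flat if the functor `M ↦ M ⊗_FI N` is exact, that is, if it takes
short exact sequences of `FI`-modules to short exact sequences of abelian groups. -/
def IsFlat (N : FIopMod) : Prop :=
  ∀ S : ShortComplex FIMod.{u}, S.ShortExact → (S.map (tensorFunctor.{u} N)).ShortExact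

end FI

/-! ### Relative singular homology -/

/-- The singular chain complex `C(X; ℤ)`. -/
def singularChains : TopCat.{0} ⥤ ChainComplex AddCommGrpCat.{0} ℕ :=
  (AlgebraicTopology.singularChainComplexFunctor AddCommGrpCat.{0}).obj (AddCommGrpCat.of ℤ)

/-- The relative singular chain complex `C(X, A; ℤ) = C(X; ℤ) / C(A; ℤ)` of a continuous map
`A → X` (here a subspace inclusion). -/
def relSingularChains : Arrow TopCat.{0} ⥤ ChainComplex AddCommGrpCat.{0} ℕ where
  obj p := cokernel (singularChains.map p.hom)
  map α := cokernel.map _ _ (singularChains.map α.left) (singularChains.map α.right)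
    (by rw [← Functor.map_comp, ← Functor.map_comp, Arrow.w])
  map_id p := by
    rw [← cancel_epi (cokernel.π _), cokernel.π_desc, Arrow.id_right, CategoryTheory.Functor.map_id]
    simp
  map_comp α β := by
    rw [← cancel_epi (cokernel.π _), cokernel.π_desc, Arrow.comp_right, CategoryTheory.Functor.map_comp]
    simp

/-- The relative singular homology group `H_k(X, A; ℤ)`. -/
def relSingularHomology (k : ℕ) : Arrow TopCat.{0} ⥤ AddCommGrpCat.{0} :=
  relSingularChains ⋙ HomologicalComplex.homologyFunctor _ _ k

/-! ### The `FI^op`-modules `Ξ(ℓ)` -/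

namespace FI

/-- The space `X_S = Emb(S, [ℓ] ⊔ ℝ)`. Since `S` is finite and discrete, an embedding is the same
as an injective map; the topology is induced by the product topology on `([ℓ] ⊔ ℝ)^S`. -/
abbrev EmbSpace (ℓ : ℕ) (S : FI) : Type :=
  {φ : S.carrier → Fin ℓ ⊕ ℝ // Function.Injective φ}

/-- The subset `A_S ⊆ X_S` of embeddings `φ` with `[ℓ] ⊈ im φ`. -/
def missing (ℓ : ℕ) (S : FI) : Set (EmbSpace ℓ S) :=
  {φ | ¬ Set.range (Sum.inl : Fin ℓ → Fin ℓ ⊕ ℝ) ⊆ Set.range φ.1}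

/-- Precomposition `X_T → X_S` with an injection `S → T`. -/
def precomp (ℓ : ℕ) {S T : FI} (g : S.carrier ↪ T.carrier) :
    C(EmbSpace ℓ T, EmbSpace ℓ S) where
  toFun φ := ⟨fun s => φ.1 (g s), φ.2.comp g.injective⟩
  continuous_toFun := by
    refine Continuous.subtype_mk (continuous_pi fun s => ?_) _
    exact (continuous_apply (g s)).comp continuous_subtype_val

theorem precomp_mem (ℓ : ℕ) {S T : FI} (g : S.carrier ↪ T.carrier) (φ : EmbSpace ℓ T)
    (h : φ ∈ missing ℓ T) : precomp ℓ g φ ∈ missing ℓ S := by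
  intro h'
  refine h (h'.trans ?_)
  rintro _ ⟨s, rfl⟩
  exact ⟨g s, rfl⟩

/-- Precomposition `A_T → A_S` with an injection `S → T`. -/
def precompMissing (ℓ : ℕ) {S T : FI} (g : S.carrier ↪ T.carrier) :
    C(missing ℓ T, missing ℓ S) where
  toFun φ := ⟨precomp ℓ g φ.1, precomp_mem ℓ g φ.1 φ.2⟩
  continuous_toFun := by fun_prop

/-- The pair `(X_S, A_S)`, as the inclusion `A_S → X_S`; injections act by precomposition. -/
def embPair (ℓ : ℕ) : FIᵒᵖ ⥤ Arrow TopCat.{0} where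
  obj S := Arrow.mk (TopCat.ofHom
    (⟨Subtype.val, continuous_subtype_val⟩ : C(missing ℓ S.unop, EmbSpace ℓ S.unop)))
  map g := Arrow.homMk (TopCat.ofHom (precompMissing ℓ g.unop)) (TopCat.ofHom (precomp ℓ g.unop)) rfl
  map_id _ := rfl
  map_comp _ _ := rfl

/-- The `FI^op`-module `Ξ(ℓ)`, with `Ξ(ℓ)_S = H_0(X_S, A_S)`. -/
def Xi (ℓ : ℕ) : FIopMod := embPair ℓ ⋙ relSingularHomology 0

end FI

end

noncomputable section

namespace FI

/-! ### A criterion for flatness -/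

section Flatness

open Filter

/-! The path components of `X_S` are the types of embeddings: the labels of the points of `S`,
together with the order of the points sent to the line (`eq_of_joined`, `SameType.joined`). `A_S` is
a union of components. So `Ξ(ℓ)_S` is free on the types in which every label occurs, and a
restriction that loses a label is zero.

Tensoring with the representable module `ℤ[Hom(-, [b])]` is evaluation at `[b]`, which is exact, and
exactness passes to retracts. It is enough that for every `k` the part of `Ξ(ℓ)` in degrees at most
`k` is such a retract, because an element and the relations that kill it involve only finitely many
degrees (`isFlat_of_retract`).

Take `ℓ = 0` first, and a finite set `F` of rationals. An injection `S → F` orders `S`; this is the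
retraction. The section sends an order to the sum of the order-preserving maps `S → F`, weighted by
an integer `C` of the image. It commutes with restriction if, for each gap of a set `A`, the numbers
`C (A ∪ {x})` with `x` in the gap add up to `C A` (`exists_gap_measure`). Such a `C` comes from
formal sums `c n` of increasing `n`-tuples such that every face of `c (n + 1)` is `c n`. They are
built recursively, since `ℚ` is dense without endpoints and so has room to insert terms
(`exists_degeneracy`, `exists_filling`).

For general `ℓ`, add to `F` two copies of each label, with weights `1` and `-1`. Summing out a
labelled point gives the factor `1 - 1 = 0`, as it must (`sum_coef_signWeight`). The retraction
sends the first copy to the label and the second to a spare real point. A compatible map using a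
second copy omits that label, so its class vanishes (`Compat.missing`). The weights thus act as `1`
and `0`, and the composite is multiplication by `C ∅ = 1` (`sum_coef_firstWeight`). -/

instance (S T : FI) : Finite (S ⟶ T) :=
  have := S.finite
  have := T.finite
  inferInstanceAs (Finite (S.carrier ↪ T.carrier))

instance (S T : FI) : Fintype (S ⟶ T) := Fintype.ofFinite _

theorem tensorSumMap_of {M M' : FIMod.{u}} (φ : M ⟶ M') (N : FIopMod) (n : ℕ)
    (t : M.obj (std n) ⊗[ℤ] N.obj (Opposite.op (std n))) :
    tensorSumMap φ N (DirectSum.of _ n t) = DirectSum.of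
      (fun n => M'.obj (std n) ⊗[ℤ] N.obj (Opposite.op (std n))) n
      (LinearMap.rTensor _ (φ.app (std n)).hom.toIntLinearMap t) := by
  rw [tensorSumMap, DirectSum.map_of]
  rfl

theorem tensorSum_induction {M : FIMod.{u}} {N : FIopMod} {P : TensorSum M N → Prop}
    (zero : P 0) (pure : ∀ n m x, P (pureTensor M N n m x))
    (add : ∀ y z, P y → P z → P (y + z)) (z : TensorSum M N) : P z := by
  induction z using DirectSum.induction_on with
  | zero => exact zero
  | of n t =>
    induction t using TensorProduct.induction_on with
    | zero => rw [map_zero]; exact zero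
    | tmul m x => exact pure n m x
    | add s t hs ht => rw [map_add]; exact add _ _ hs ht
  | add y z hy hz => exact add _ _ hy hz

theorem tensorSumMap_surjective {M M' : FIMod.{u}} (φ : M ⟶ M') (N : FIopMod)
    (h : ∀ n, Function.Surjective (φ.app (std n))) : Function.Surjective (tensorSumMap φ N) := by
  intro z
  induction z using tensorSum_induction with
  | zero => exact ⟨0, map_zero _⟩
  | pure n m x =>
    obtain ⟨m, rfl⟩ := h n m
    exact ⟨_, tensorSumMap_pureTensor φ N n m x⟩
  | add y z hy hz =>
    obtain ⟨y, rfl⟩ := hy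
    obtain ⟨z, rfl⟩ := hz
    exact ⟨y + z, map_add _ _ _⟩

/-- A generating relation lifts as soon as its module element in `M'_a` does. -/
theorem exists_mem_tensorRel {M M' : FIMod.{u}} (φ : M ⟶ M') (N : FIopMod)
    (h : ∀ n, Function.Surjective (φ.app (std n))) {z : TensorSum M' N}
    (hz : z ∈ tensorRel M' N) : ∃ y ∈ tensorRel M N, tensorSumMap φ N y = z := by
  induction hz using AddSubgroup.closure_induction with
  | mem z hz =>
    obtain ⟨a, b, f, m, x, rfl⟩ := hz
    obtain ⟨m, rfl⟩ := h a m
    refine ⟨_, AddSubgroup.subset_closure ⟨a, b, f, m, x, rfl⟩, ?_⟩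
    rw [map_sub, tensorSumMap_pureTensor, tensorSumMap_pureTensor, NatTrans.naturality_apply]
  | zero => exact ⟨0, zero_mem _, map_zero _⟩
  | add y z _ _ hy hz =>
    obtain ⟨y, hy', rfl⟩ := hy
    obtain ⟨z, hz', rfl⟩ := hz
    exact ⟨y + z, add_mem hy' hz', map_add _ _ _⟩
  | neg y _ hy =>
    obtain ⟨y, hy', rfl⟩ := hy
    exact ⟨-y, neg_mem hy', map_neg _ _⟩

theorem exists_of_tensorSumMap_eq_zero {M' M M'' : FIMod.{u}} (f : M' ⟶ M) (g : M ⟶ M'')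
    (N : FIopMod) (hfg : ∀ n, Function.Exact (f.app (std n)) (g.app (std n)))
    (hg : ∀ n, Function.Surjective (g.app (std n))) {y : TensorSum M N}
    (hy : tensorSumMap g N y = 0) : ∃ x, tensorSumMap f N x = y := by
  classical
  have hcomp (n : ℕ) : ∃ t, LinearMap.rTensor (N.obj (Opposite.op (std n)))
      (f.app (std n)).hom.toIntLinearMap t = y n := by
    have hex := rTensor_exact (N.obj (Opposite.op (std n)))
      (f := (f.app (std n)).hom.toIntLinearMap) (g := (g.app (std n)).hom.toIntLinearMap)
      (hfg n) (hg n)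
    refine (hex (y n)).1 ?_
    have := congrArg (fun z => z n) hy
    rw [tensorSumMap] at this
    exact this
  choose t ht using hcomp
  refine ⟨∑ n ∈ DFinsupp.support y, DirectSum.of _ n (t n), ?_⟩
  rw [map_sum]
  simp only [tensorSumMap_of, ht]
  exact DirectSum.sum_support_of y

/-- Right exactness needs nothing of `N`: after subtracting a lifted relation, the representative
dies already in the direct sum, where right exactness of `⊗` over `ℤ` applies degreewise. -/
theorem tensorMap_exact {M' M M'' : FIMod.{u}} (f : M' ⟶ M) (g : M ⟶ M'')
    (N : FIopMod) (hfg : ∀ n, Function.Exact (f.app (std n)) (g.app (std n)))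
    (hg : ∀ n, Function.Surjective (g.app (std n))) {y : Tensor M N} (hy : tensorMap g N y = 0) :
    ∃ x, tensorMap f N x = y := by
  obtain ⟨y, rfl⟩ := QuotientAddGroup.mk_surjective y
  have hy' : tensorSumMap g N y ∈ tensorRel M'' N := (QuotientAddGroup.eq_zero_iff _).1 hy
  obtain ⟨r, hr, hry⟩ := exists_mem_tensorRel g N hg hy'
  obtain ⟨x, hx⟩ := exists_of_tensorSumMap_eq_zero f g N hfg hg (y := y - r)
    (by rw [map_sub, hry, sub_self])
  refine ⟨QuotientAddGroup.mk x, ?_⟩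
  have : tensorMap f N (QuotientAddGroup.mk x) = QuotientAddGroup.mk (tensorSumMap f N x) := rfl
  rw [this, hx, QuotientAddGroup.eq]
  simpa using hr

/-- The map `⨁ₙ Mₙ ⊗ Nₙ → M_b` that sends `m ⊗ x`, for `m ∈ Mₙ` and `n ≤ k`, to the image of `m`
under the formal sum of injections `[n] → [b]` given by `x`. -/
def evalSum (M : FIMod.{u}) {N : FIopMod} (k b : ℕ)
    (c : ∀ n, N.obj (Opposite.op (std n)) →+ ((std n ⟶ std b) → ℤ)) :
    TensorSum M N →+ M.obj (std b) :=
  DirectSum.toAddMonoid fun n => if n ≤ k then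
    (TensorProduct.lift (LinearMap.mk₂ ℤ
      (fun (m : M.obj (std n)) (x : N.obj (Opposite.op (std n))) =>
        ∑ g : std n ⟶ std b, c n x g • M.map g m)
      (fun m m' x => by simp only [map_add, smul_add, Finset.sum_add_distrib])
      (fun r m x => by simp only [map_zsmul, Finset.smul_sum, smul_comm r])
      (fun m x x' => by simp only [map_add, Pi.add_apply, add_smul, Finset.sum_add_distrib])
      (fun r m x => by simp only [map_zsmul, Finset.smul_sum, Pi.smul_apply, smul_assoc]))
      ).toAddMonoidHom else 0

theorem evalSum_pureTensor (M : FIMod.{u}) {N : FIopMod} {k b : ℕ}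
    (c : ∀ n, N.obj (Opposite.op (std n)) →+ ((std n ⟶ std b) → ℤ)) {n : ℕ} (hn : n ≤ k)
    (m : M.obj (std n)) (x : N.obj (Opposite.op (std n))) :
    evalSum M k b c (pureTensor M N n m x) = ∑ g : std n ⟶ std b, c n x g • M.map g m := by
  rw [evalSum, pureTensor, DirectSum.toAddMonoid_of, if_pos hn]
  rfl

theorem evalSum_naturality {M M' : FIMod.{u}} (φ : M ⟶ M') {N : FIopMod} (k b : ℕ)
    (c : ∀ n, N.obj (Opposite.op (std n)) →+ ((std n ⟶ std b) → ℤ)) (z : TensorSum M N) :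
    evalSum M' k b c (tensorSumMap φ N z) = φ.app (std b) (evalSum M k b c z) := by
  induction z using tensorSum_induction with
  | zero => simp only [map_zero]
  | pure n m x =>
    rw [tensorSumMap_pureTensor]
    by_cases hn : n ≤ k
    · rw [evalSum_pureTensor _ _ hn, evalSum_pureTensor _ _ hn, map_sum]
      exact Finset.sum_congr rfl fun g _ => by rw [map_zsmul, NatTrans.naturality_apply]
    · simp only [evalSum, pureTensor, DirectSum.toAddMonoid_of, if_neg hn, AddMonoidHom.zero_apply,
        map_zero]
  | add y z hy hz => simp only [map_add, hy, hz]

theorem tmk_map {M : FIMod.{u}} {N : FIopMod} {a b : ℕ} (f : std a ⟶ std b) (m : M.obj (std a))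
    (x : N.obj (Opposite.op (std b))) :
    tmk M N b (M.map f m) x = tmk M N a m (N.map f.op x) := by
  refine (QuotientAddGroup.eq_iff_sub_mem).2 ?_
  exact AddSubgroup.subset_closure ⟨a, b, f, m, x, rfl⟩

/-- `m ↦ m ⊗ v` as a homomorphism. -/
def tmkLeft (M : FIMod.{u}) (N : FIopMod) (b : ℕ) (v : N.obj (Opposite.op (std b))) :
    M.obj (std b) →+ Tensor M N where
  toFun m := tmk M N b m v
  map_zero' := by rw [tmk, pureTensor, TensorProduct.zero_tmul, map_zero, map_zero]
  map_add' m m' := by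
    simp only [tmk, pureTensor, TensorProduct.add_tmul, map_add]

/-- `x ↦ m ⊗ x` as a homomorphism. -/
def tmkRight (M : FIMod.{u}) (N : FIopMod) (b : ℕ) (m : M.obj (std b)) :
    N.obj (Opposite.op (std b)) →+ Tensor M N where
  toFun x := tmk M N b m x
  map_zero' := by rw [tmk, pureTensor, TensorProduct.tmul_zero, map_zero, map_zero]
  map_add' m m' := by
    simp only [tmk, pureTensor, TensorProduct.tmul_add, map_add]

/-- An `FI^op`-module is flat if each of its truncations is a retract of a truncated representable
module, compatibly with the module itself. -/
theorem isFlat_of_retract (N : FIopMod)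
    (H : ∀ k : ℕ, ∃ (b : ℕ) (v : N.obj (Opposite.op (std b)))
      (c : ∀ n, N.obj (Opposite.op (std n)) →+ ((std n ⟶ std b) → ℤ)),
      (∀ (n m : ℕ) (f : std n ⟶ std m) (x : N.obj (Opposite.op (std m))) (g' : std n ⟶ std b),
        m ≤ k → c n (N.map f.op x) g' =
          ∑ g : std m ⟶ std b, open Classical in if f ≫ g = g' then c m x g else 0) ∧
      ∀ n ≤ k, ∀ x, ∑ g : std n ⟶ std b, c n x g • N.map g.op v = x) :
    IsFlat.{u} N := by
  classical
  choose b v c hnat hid using H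
  have hle {n m : ℕ} (f : std n ⟶ std m) : n ≤ m := by
    simpa using Fintype.card_le_of_embedding (show Fin n ↪ Fin m from f)
  -- For fixed `k` the evaluation need not respect relations reaching degrees above `k`, so it is
  -- not defined on the tensor product. A given element of `tensorRel` uses finitely many relations
  -- and is killed for all large `k`.
  have hrel (M : FIMod.{u}) {z : TensorSum M N} (hz : z ∈ tensorRel M N) :
      ∀ᶠ k in atTop, evalSum M k (b k) (c k) z = 0 := by
    induction hz using AddSubgroup.closure_induction with
    | mem z hz =>
      obtain ⟨n, m, f, y, x, rfl⟩ := hz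
      filter_upwards [eventually_ge_atTop m] with k hk
      rw [map_sub, evalSum_pureTensor _ _ hk, evalSum_pureTensor _ _ ((hle f).trans hk),
        sub_eq_zero]
      simp only [hnat k n m f x _ hk, Finset.sum_smul, ite_smul, zero_smul]
      rw [Finset.sum_comm]
      refine Finset.sum_congr rfl fun g _ => ?_
      rw [Finset.sum_ite_eq, if_pos (Finset.mem_univ _), Functor.map_comp, ConcreteCategory.comp_apply]
    | zero => simp
    | add y z _ _ hy hz => filter_upwards [hy, hz] with k h1 h2; rw [map_add, h1, h2, add_zero]
    | neg y _ hy => filter_upwards [hy] with k h1; rw [map_neg, h1, neg_zero]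
  have hret (M : FIMod.{u}) (z : TensorSum M N) : ∀ᶠ k in atTop,
      tmkLeft M N (b k) (v k) (evalSum M k (b k) (c k) z) = QuotientAddGroup.mk z := by
    induction z using tensorSum_induction with
    | zero => simp
    | pure n m x =>
      filter_upwards [eventually_ge_atTop n] with k hk
      rw [evalSum_pureTensor _ _ hk, map_sum]
      have : ∀ g : std n ⟶ std (b k), tmkLeft M N (b k) (v k) (c k n x g • M.map g m) =
          tmkRight M N n m (c k n x g • N.map g.op (v k)) := fun g => by
        rw [map_zsmul, map_zsmul]
        exact congrArg _ (tmk_map g m (v k))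
      simp only [this, ← map_sum, hid k n hk x]
      rfl
    | add y z hy hz =>
      filter_upwards [hy, hz] with k h1 h2
      rw [map_add, map_add, h1, h2]
      rfl
  intro S hS
  have hev (n : ℕ) := hS.map_of_exact ((evaluation FI AddCommGrpCat.{u}).obj (std n))
  have hf (n : ℕ) : Function.Injective (S.f.app (std n)) := (hev n).ab_injective_f
  have hg (n : ℕ) : Function.Surjective (S.g.app (std n)) := (hev n).ab_surjective_g
  have hfg (n : ℕ) : Function.Exact (S.f.app (std n)) (S.g.app (std n)) :=
    (ShortComplex.ab_exact_iff_function_exact _).1 (hev n).exact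
  refine ShortComplex.ShortExact.mk' ?_ ?_ ?_
  · rw [ShortComplex.ab_exact_iff]
    exact fun y hy => tensorMap_exact S.f S.g N hfg hg hy
  · refine (AddCommGrpCat.mono_iff_injective _).2 ?_
    refine (injective_iff_map_eq_zero (tensorMap S.f N)).2 fun z hz => ?_
    obtain ⟨z, rfl⟩ := QuotientAddGroup.mk_surjective z
    have hz' : tensorSumMap S.f N z ∈ tensorRel S.X₂ N := (QuotientAddGroup.eq_zero_iff _).1 hz
    -- One `k` large enough both for the relations that kill the image and for recovering `z` from
    -- its evaluation; injectivity of `S.f` at `[b k]` then finishes.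
    obtain ⟨k, h1, h2⟩ := ((hrel _ hz').and (hret _ z)).exists
    rw [evalSum_naturality] at h1
    rw [← h2, hf _ (h1.trans (map_zero _).symm), map_zero]
  · refine (AddCommGrpCat.epi_iff_surjective _).2 fun z => ?_
    obtain ⟨z, rfl⟩ := QuotientAddGroup.mk_surjective z
    obtain ⟨y, rfl⟩ := tensorSumMap_surjective S.g N hg z
    exact ⟨QuotientAddGroup.mk y, rfl⟩

end Flatness

/-! ### Relative singular homology in degree zero -/

/-! ### Zero-chains and boundaries of edges in a simplicial set -/

section SimplicialChains

variable (X : SSet.{0})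

/-- The integral chain complex of a simplicial set. -/
abbrev intChains : ChainComplex AddCommGrpCat.{0} ℕ := X.chainComplex (AddCommGrpCat.of ℤ)

variable {X}

/-- The `0`-chain of a vertex. -/
def vertexChain (x : X.obj (.op (.mk 0))) : (intChains X).X 0 :=
  X.ιChainComplex (R := AddCommGrpCat.of ℤ) x (1 : ℤ)

theorem vertexChain_hom_ext {B : AddCommGrpCat.{0}} {f g : (intChains X).X 0 ⟶ B}
    (h : ∀ x, f (vertexChain x) = g (vertexChain x)) : f = g :=
  SSet.chainComplex_hom_ext fun x => AddCommGrpCat.int_hom_ext _ _ (h x)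

theorem vertexChain_map {Y : SSet.{0}} (f : X ⟶ Y) (x : X.obj (.op (.mk 0))) :
    (SSet.chainComplexMap f (AddCommGrpCat.of ℤ)).f 0 (vertexChain x) =
      vertexChain (f.app _ x) := by
  have := SSet.ι_chainComplexMap_f (X := X) (Y := Y) (f := f) (R := AddCommGrpCat.of ℤ) (x := x)
  exact congrArg (fun φ => φ (1 : ℤ)) this

theorem d_edgeChain (s : X.obj (.op (.mk 1))) :
    (intChains X).d 1 0 (X.ιChainComplex (R := AddCommGrpCat.of ℤ) s (1 : ℤ)) =
      vertexChain (X.δ 0 s) - vertexChain (X.δ 1 s) := by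
  have hd := SSet.ιChainComplex_d X (R := AddCommGrpCat.of ℤ) s
  refine (ConcreteCategory.congr_hom hd (1 : ℤ)).trans ?_
  have h (a b : AddCommGrpCat.of ℤ ⟶ (intChains X).X 0) :
      (∑ i : Fin 2, (-1) ^ i.val • ![a, b] i) (1 : ℤ) = a (1 : ℤ) - b (1 : ℤ) := by
    simp [Fin.sum_univ_two, sub_eq_add_neg]
  refine Eq.trans ?_ (h _ _)
  congr 2

theorem exists_vertexChain_desc {B : AddCommGrpCat.{0}} (F : X.obj (.op (.mk 0)) → B) :
    ∃ f : (intChains X).X 0 ⟶ B, ∀ x, f (vertexChain x) = F x := by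
  refine ⟨Cofan.IsColimit.desc (X.isColimitChainComplexXCofan (AddCommGrpCat.of ℤ) 0)
    fun s => AddCommGrpCat.ofHom (zmultiplesHom B (F s)), fun x => ?_⟩
  have := Cofan.IsColimit.fac (X.isColimitChainComplexXCofan (AddCommGrpCat.of ℤ) 0)
    (fun s => AddCommGrpCat.ofHom (zmultiplesHom B (F s))) x
  refine (congrArg (fun φ => φ (1 : ℤ)) this).trans ?_
  exact one_zsmul _

theorem d_hom_eq_zero {B : AddCommGrpCat.{0}} {f : (intChains X).X 0 ⟶ B}
    (hf : ∀ s : X.obj (.op (.mk 1)), f (vertexChain (X.δ 0 s)) = f (vertexChain (X.δ 1 s))) :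
    (intChains X).d 1 0 ≫ f = 0 := by
  refine SSet.chainComplex_hom_ext fun s => AddCommGrpCat.int_hom_ext _ _ ?_
  refine (congrArg f (d_edgeChain s)).trans ?_
  rw [map_sub, hf, sub_self]
  rfl

end SimplicialChains

/-! ### Degree-zero homology of a cokernel of chain complexes -/

section Cokernel

variable {K L : ChainComplex AddCommGrpCat.{0} ℕ} (φ : K ⟶ L)

/-- The projection from the `0`-chains to the homology of a cokernel. -/
def toCokernelHomology : L.X 0 ⟶ (cokernel φ).homology 0 :=
  (cokernel.π φ).f 0 ≫ (cokernel φ).pOpcycles 0 ≫ (ChainComplex.isoHomologyι₀ (cokernel φ)).inv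

instance : Epi (toCokernelHomology φ) := by
  unfold toCokernelHomology
  have : Epi ((cokernel.π φ).f 0) :=
    inferInstanceAs (Epi ((HomologicalComplex.eval _ _ 0).map (cokernel.π φ)))
  have h1 : Epi ((cokernel φ).pOpcycles 0 ≫ (ChainComplex.isoHomologyι₀ (cokernel φ)).inv) :=
    epi_comp _ _
  exact epi_comp _ _

theorem toCokernelHomology_naturality {K' L' : ChainComplex AddCommGrpCat.{0} ℕ} {φ' : K' ⟶ L'}
    (α : K ⟶ K') (β : L ⟶ L') (w : φ ≫ β = α ≫ φ') :
    toCokernelHomology φ ≫ HomologicalComplex.homologyMap (cokernel.map φ φ' α β w) 0 =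
      β.f 0 ≫ toCokernelHomology φ' := by
  unfold toCokernelHomology
  have h : (ChainComplex.isoHomologyι₀ (cokernel φ)).inv ≫
      HomologicalComplex.homologyMap (cokernel.map φ φ' α β w) 0 =
        HomologicalComplex.opcyclesMap (cokernel.map φ φ' α β w) 0 ≫
        (ChainComplex.isoHomologyι₀ (cokernel φ')).inv := by
    rw [Iso.inv_comp_eq, ← Category.assoc, Iso.eq_comp_inv]
    exact HomologicalComplex.homologyι_naturality _ _
  rw [Category.assoc, Category.assoc, h, HomologicalComplex.p_opcyclesMap_assoc,
    ← HomologicalComplex.comp_f_assoc, cokernel.π_desc, HomologicalComplex.comp_f_assoc]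

theorem comp_toCokernelHomology : φ.f 0 ≫ toCokernelHomology φ = 0 := by
  unfold toCokernelHomology
  rw [← HomologicalComplex.comp_f_assoc, cokernel.condition]
  simp

theorem d_toCokernelHomology : L.d 1 0 ≫ toCokernelHomology φ = 0 := by
  unfold toCokernelHomology
  rw [← HomologicalComplex.Hom.comm_assoc, HomologicalComplex.d_pOpcycles_assoc]
  simp

/-- A map killing boundaries is a chain map to `B` placed in degree zero; killing the image of `K`
lets it descend to the cokernel. -/
theorem exists_toCokernelHomology_desc {B : AddCommGrpCat.{0}} (f : L.X 0 ⟶ B)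
    (hd : L.d 1 0 ≫ f = 0) (hf : φ.f 0 ≫ f = 0) :
    ∃ g : (cokernel φ).homology 0 ⟶ B, toCokernelHomology φ ≫ g = f := by
  let F : L ⟶ (ChainComplex.single₀ _).obj B := (ChainComplex.toSingle₀Equiv _ _).symm ⟨f, hd⟩
  have hF0 : F.f 0 = f := congrArg Subtype.val ((ChainComplex.toSingle₀Equiv L B).right_inv ⟨f, hd⟩)
  have hF : φ ≫ F = 0 := by
    refine (ChainComplex.toSingle₀Equiv _ _).injective (Subtype.ext ?_)
    refine (HomologicalComplex.comp_f _ _ _).trans ?_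
    rw [hF0]
    exact hf
  obtain ⟨g, hg⟩ : ∃ g : (cokernel φ).X 0 ⟶ B, g = (cokernel.desc φ F hF).f 0 := ⟨_, rfl⟩
  have hG : (cokernel.π φ).f 0 ≫ g = f := by
    rw [hg, ← hF0]
    exact congrArg (fun φ => φ.f 0) (cokernel.π_desc φ F hF)
  have hdg : (cokernel φ).d 1 0 ≫ g = 0 := by
    rw [hg]
    refine ((cokernel.desc φ F hF).comm 1 0).symm.trans ?_
    rw [HomologicalComplex.single_obj_d]
    exact comp_zero
  refine ⟨(ChainComplex.isoHomologyι₀ (cokernel φ)).hom ≫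
    (cokernel φ).descOpcycles g 1 (by simp) hdg, ?_⟩
  unfold toCokernelHomology
  simp only [Category.assoc, Iso.inv_hom_id_assoc, HomologicalComplex.p_descOpcycles]
  exact hG

end Cokernel

/-! ### Relative `H_0` by generators and relations: points, paths, and the subspace -/

/-- The class of a point in relative homology. -/
def pointClass (p : Arrow TopCat.{0}) (x : p.right) : (relSingularHomology 0).obj p :=
  toCokernelHomology (singularChains.map p.hom)
    (vertexChain (X := TopCat.toSSet.obj p.right) (TopCat.toSSetObj₀Equiv.symm x))

theorem pointClass_hom_ext {p : Arrow TopCat.{0}} {B : Type} [AddCommGroup B]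
    {f g : (relSingularHomology 0).obj p →+ B} (h : ∀ x, f (pointClass p x) = g (pointClass p x)) :
    f = g := by
  have : AddCommGrpCat.ofHom f = AddCommGrpCat.ofHom g := by
    refine (cancel_epi (toCokernelHomology (singularChains.map p.hom))).1 ?_
    refine vertexChain_hom_ext (X := TopCat.toSSet.obj p.right) fun x => ?_
    have := h (TopCat.toSSetObj₀Equiv x)
    unfold pointClass at this
    rw [Equiv.symm_apply_apply] at this
    exact this
  exact congrArg AddCommGrpCat.Hom.hom this

theorem pointClass_map {p q : Arrow TopCat.{0}} (α : p ⟶ q) (x : p.right) :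
    (relSingularHomology 0).map α (pointClass p x) = pointClass q (α.right x) := by
  have h := toCokernelHomology_naturality (singularChains.map p.hom)
    (φ' := singularChains.map q.hom) (singularChains.map α.left) (singularChains.map α.right)
    (by rw [← Functor.map_comp, ← Functor.map_comp, Arrow.w])
  have h2 := vertexChain_map (TopCat.toSSet.map α.right) (TopCat.toSSetObj₀Equiv.symm x)
  refine (congrArg (fun φ => φ (vertexChain (X := TopCat.toSSet.obj p.right)
    (TopCat.toSSetObj₀Equiv.symm x))) h).trans ?_
  exact congrArg (toCokernelHomology (singularChains.map q.hom)) h2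

theorem pointClass_eq_of_joined {p : Arrow TopCat.{0}} {x y : p.right} (h : Joined x y) :
    pointClass p x = pointClass p y := by
  obtain ⟨γ⟩ := h
  let e := TopCat.toSSetObjEdgeEquiv.symm (TopCat.pathEquiv.symm γ)
  have h1 := d_edgeChain (X := TopCat.toSSet.obj p.right) e.edge
  have h2 : (SimplicialObject.δ (TopCat.toSSet.obj p.right) 1) e.edge =
    TopCat.toSSetObj₀Equiv.symm x := e.src_eq
  have h3 : (SimplicialObject.δ (TopCat.toSSet.obj p.right) 0) e.edge =
    TopCat.toSSetObj₀Equiv.symm y := e.tgt_eq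
  rw [h2, h3] at h1
  have h4 := d_toCokernelHomology (singularChains.map p.hom)
  have h5 := (congrArg (toCokernelHomology (singularChains.map p.hom)) h1).symm.trans
    (ConcreteCategory.congr_hom h4 _)
  have h6 := (map_sub (toCokernelHomology (singularChains.map p.hom)).hom _ _).symm.trans h5
  exact (sub_eq_zero.1 h6).symm

theorem pointClass_eq_zero (p : Arrow TopCat.{0}) (x : p.left) : pointClass p (p.hom x) = 0 := by
  have h2 := vertexChain_map (TopCat.toSSet.map p.hom) (TopCat.toSSetObj₀Equiv.symm x)
  exact (congrArg (toCokernelHomology (singularChains.map p.hom)) h2).symm.trans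
    (ConcreteCategory.congr_hom (comp_toCokernelHomology (singularChains.map p.hom)) _)

/-- Singular 1-simplices are paths, so the linear extension of `F` to 0-chains kills boundaries. -/
theorem exists_pointClass_desc (p : Arrow TopCat.{0}) {B : Type} [AddCommGroup B] (F : p.right → B)
    (hF : ∀ x y, Joined x y → F x = F y) (h0 : ∀ x : p.left, F (p.hom x) = 0) :
    ∃ g : (relSingularHomology 0).obj p →+ B, ∀ x, g (pointClass p x) = F x := by
  obtain ⟨f, hf⟩ := exists_vertexChain_desc (X := TopCat.toSSet.obj p.right)
    (B := AddCommGrpCat.of B) fun s => F (TopCat.toSSetObj₀Equiv s)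
  obtain ⟨g, hg⟩ := exists_toCokernelHomology_desc (singularChains.map p.hom) f
    (d_hom_eq_zero fun s => by
      rw [hf, hf]
      refine (hF _ _ ⟨TopCat.pathEquiv (TopCat.toSSetObjEdgeEquiv ?_)⟩).symm
      exact SSet.Edge.mk s (by simp) (by simp))
    (vertexChain_hom_ext (X := TopCat.toSSet.obj p.left) fun x => by
      have h2 := vertexChain_map (TopCat.toSSet.map p.hom) x
      refine (congrArg f h2).trans ((hf _).trans ?_)
      exact h0 (TopCat.toSSetObj₀Equiv x))
  refine ⟨g.hom, fun x => ?_⟩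
  refine (ConcreteCategory.congr_hom hg _).trans ((hf _).trans ?_)
  rw [Equiv.apply_symm_apply]

/-! ### A consistent family of signed measures on increasing tuples -/

section IncreasingTuples

/-- Integral formal sums of rational sequences. -/
abbrev SeqSum : Type := (ℕ → ℚ) →₀ ℤ

/-- The increasing map `ℕ → ℕ` that omits the value `i`. -/
def skip (i x : ℕ) : ℕ := if x < i then x else x + 1

/-- Deletion of the `i`-th term of a sequence, extended to formal sums. -/
def face (i : ℕ) : SeqSum →ₗ[ℤ] SeqSum := Finsupp.lmapDomain ℤ ℤ fun a x => a (skip i x)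

/-- Insertion of the value `v a` as the `j`-th term of a sequence `a`. -/
def insertAt (j : ℕ) (v : (ℕ → ℚ) → ℚ) (a : ℕ → ℚ) (x : ℕ) : ℚ :=
  if x < j then a x else if x = j then v a else a (x - 1)

/-- Formal sums of sequences whose first `n` terms increase strictly. -/
def increasing (n : ℕ) : Submodule ℤ SeqSum :=
  Finsupp.supported ℤ ℤ {a | StrictMonoOn a (Set.Iio n)}

theorem face_face {i j : ℕ} (h : i < j) (z : SeqSum) :
    face i (face j z) = face (j - 1) (face i z) := by
  simp only [face, ← LinearMap.comp_apply, ← Finsupp.lmapDomain_comp]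
  congr 2
  funext a x
  simp only [Function.comp_apply, skip]
  congr 1
  split_ifs <;> omega

theorem face_insertAt_self (j : ℕ) (v : (ℕ → ℚ) → ℚ) (w : SeqSum) :
    face j (Finsupp.lmapDomain ℤ ℤ (insertAt j v) w) = w := by
  simp only [face, ← LinearMap.comp_apply, ← Finsupp.lmapDomain_comp]
  refine Eq.trans (congrArg (fun f => Finsupp.lmapDomain ℤ ℤ f w) (a₂ := id) ?_)
    (LinearMap.congr_fun (Finsupp.lmapDomain_id ℤ ℤ) w)
  funext a x
  simp only [Function.comp_apply, skip, insertAt, id]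
  split_ifs <;> first | omega | rfl

/-- By `hv` the inserted value does not depend on the `i`-th term, so insertion and deletion
commute. -/
theorem face_insertAt {i j : ℕ} (h : i < j) {v v' : (ℕ → ℚ) → ℚ}
    (hv : ∀ a, v a = v' fun x => a (skip i x)) (w : SeqSum) :
    face i (Finsupp.lmapDomain ℤ ℤ (insertAt j v) w) =
      Finsupp.lmapDomain ℤ ℤ (insertAt (j - 1) v') (face i w) := by
  simp only [face, ← LinearMap.comp_apply, ← Finsupp.lmapDomain_comp]
  congr 2
  funext a x
  simp only [Function.comp_apply, insertAt, ← hv]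
  unfold skip
  split_ifs <;> first | omega | rfl | (congr 1; omega)

theorem lmapDomain_mem_increasing {n : ℕ} {f : (ℕ → ℚ) → ℕ → ℚ} {w : SeqSum}
    (h : ∀ a ∈ w.support, StrictMonoOn (f a) (Set.Iio n)) :
    Finsupp.lmapDomain ℤ ℤ f w ∈ increasing n := by
  classical
  rw [increasing, Finsupp.mem_supported]
  intro b hb
  obtain ⟨a, ha, rfl⟩ := Finset.mem_image.1 (Finsupp.mapDomain_support hb)
  exact h a ha

theorem face_mem_increasing {n j : ℕ} {z : SeqSum} (hz : z ∈ increasing (n + 1)) :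
    face j z ∈ increasing n := by
  refine lmapDomain_mem_increasing fun a ha x hx y hy hxy => hz ha ?_ ?_ ?_ <;>
    simp only [Set.mem_Iio, skip] at * <;> split_ifs <;> omega

theorem strictMonoOn_insertAt {n j : ℕ} (hj : j ≤ n) {v : (ℕ → ℚ) → ℚ} {a : ℕ → ℚ}
    (ha : StrictMonoOn a (Set.Iio n)) (hlt : 0 < j → a (j - 1) < v a) (hgt : j < n → v a < a j) :
    StrictMonoOn (insertAt j v a) (Set.Iio (n + 1)) := by
  have hlt' : ∀ x < j, a x < v a := fun x hx =>
    (ha.monotoneOn (Set.mem_Iio.2 (by omega)) (Set.mem_Iio.2 (by omega)) (by omega)).trans_lt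
      (hlt (by omega))
  have hgt' : ∀ x, j ≤ x → x < n → v a < a x := fun x hx hxn =>
    (hgt (by omega)).trans_le
      (ha.monotoneOn (Set.mem_Iio.2 (by omega)) (Set.mem_Iio.2 (by omega)) (by omega))
  intro x hx y hy hxy
  simp only [Set.mem_Iio] at hx hy
  unfold insertAt
  split_ifs
  all_goals first
    | omega
    | exact ha (Set.mem_Iio.2 (by omega)) (Set.mem_Iio.2 (by omega)) (by omega)
    | exact hlt' _ (by omega)
    | exact hgt' _ (by omega) (by omega)

theorem exists_pos_lt_of_finset {ι : Type*} (s : Finset ι) (f : ι → ℚ) (hf : ∀ a ∈ s, 0 < f a) :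
    ∃ δ : ℚ, 0 < δ ∧ ∀ a ∈ s, δ < f a := by
  classical
  induction s using Finset.induction_on with
  | empty => exact ⟨1, one_pos, by simp⟩
  | insert a s _ ih =>
    obtain ⟨δ, h0, h⟩ := ih fun b hb => hf b (Finset.mem_insert_of_mem hb)
    have ha := hf a (Finset.mem_insert_self _ _)
    refine ⟨min δ (f a / 2), lt_min h0 (half_pos ha), fun b hb => ?_⟩
    rcases Finset.mem_insert.1 hb with rfl | hb
    · exact (min_le_right _ _).trans_lt (half_lt_self ha)
    · exact (min_le_left _ _).trans_lt (h b hb)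

/-- Inserting a `j`-th term has a version on formal sums that is right inverse to the `j`-th face
and preserves the vanishing of earlier faces. -/
theorem exists_degeneracy {n j : ℕ} (hj : j ≤ n) {w : SeqSum} (hw : w ∈ increasing n)
    (h0 : ∀ i < j, face i w = 0) :
    ∃ z ∈ increasing (n + 1), face j z = w ∧ ∀ i < j, face i z = 0 := by
  rcases hj.lt_or_eq with hjn | rfl
  -- Insert just below `a j`, by less than every gap `a j - a (j - 1)` in the support. The reference
  -- term `a j` survives the deletion of any earlier term, unlike `a (j - 1)`. For `j = 0` there is
  -- no lower neighbour and the bound `1` is a dummy.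
  · obtain ⟨δ, hδ, hlt⟩ := exists_pos_lt_of_finset w.support
      (fun a => if 0 < j then a j - a (j - 1) else 1) fun a ha => by
        split_ifs with h
        · exact sub_pos.2
            (hw ha (Set.mem_Iio.2 (by omega)) (Set.mem_Iio.2 (by omega)) (by omega))
        · exact one_pos
    refine ⟨Finsupp.lmapDomain ℤ ℤ (insertAt j fun a => a j - δ) w,
      lmapDomain_mem_increasing fun a ha => strictMonoOn_insertAt hj (hw ha) (fun h => ?_)
        fun _ => sub_lt_self _ hδ, face_insertAt_self _ _ _, fun i hi => ?_⟩
    · have := hlt a ha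
      rw [if_pos h] at this
      linarith
    · rw [face_insertAt hi (v' := fun a => a (j - 1) - δ), h0 i hi, map_zero]
      intro a
      have : skip i (j - 1) = j := by unfold skip; split_ifs <;> omega
      simp only [this]
  -- At the end there is no `a j`; append one constant above all last terms.
  · obtain ⟨K, hK⟩ := (w.support.image fun a => a (j - 1)).bddAbove
    refine ⟨Finsupp.lmapDomain ℤ ℤ (insertAt j fun _ => K + 1) w,
      lmapDomain_mem_increasing fun a ha => strictMonoOn_insertAt hj (hw ha) (fun h => ?_)
        fun h => absurd h (lt_irrefl _), face_insertAt_self _ _ _, fun i hi => ?_⟩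
    · exact (hK (Finset.mem_coe.2 (Finset.mem_image_of_mem _ ha))).trans_lt (lt_add_one K)
    · rw [face_insertAt hi (v' := fun _ => K + 1) fun _ => rfl, h0 i hi, map_zero]

/-- The faces are corrected one at a time. If those before `j` are right, the error `c - face j z`
has vanishing earlier faces by the simplicial identity and `hf`, so adding its degeneracy repairs
face `j` without disturbing them. -/
theorem exists_filling {n : ℕ} {c : SeqSum} (hc : c ∈ increasing n)
    (hf : ∀ i < n, ∀ i' < n, face i c = face i' c) :
    ∃ z ∈ increasing (n + 1), ∀ i ≤ n, face i z = c := by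
  suffices ∀ j ≤ n + 1, ∃ z ∈ increasing (n + 1), ∀ i < j, face i z = c by
    obtain ⟨z, hz, h⟩ := this (n + 1) le_rfl
    exact ⟨z, hz, fun i hi => h i (by omega)⟩
  intro j hj
  induction j with
  | zero => exact ⟨0, zero_mem _, by simp⟩
  | succ j ih =>
    obtain ⟨z, hz, h⟩ := ih (by omega)
    obtain ⟨s, hs, hsj, hs0⟩ := exists_degeneracy (n := n) (j := j) (w := c - face j z) (by omega)
      (sub_mem hc (face_mem_increasing hz)) fun i hi => by
        rw [map_sub, face_face hi, h i hi, hf i (by omega) (j - 1) (by omega), sub_self]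
    refine ⟨z + s, add_mem hz hs, fun i hi => ?_⟩
    rcases (Nat.lt_succ_iff.1 hi).lt_or_eq with hi | rfl
    · rw [map_add, h i hi, hs0 i hi, add_zero]
    · rw [map_add, hsj, add_sub_cancel]

/-- A filling of `c n` has all its faces equal, so it can be filled in turn. -/
theorem exists_consistent_seqSum : ∃ c : ℕ → SeqSum, c 0 = Finsupp.single 0 1 ∧
    (∀ n, c n ∈ increasing n) ∧ ∀ n, ∀ i ≤ n, face i (c (n + 1)) = c n := by
  let T (n : ℕ) := {c : SeqSum // c ∈ increasing n ∧ ∀ i < n, ∀ i' < n, face i c = face i' c}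
  have hstep (n : ℕ) (c : T n) : ∃ z : T (n + 1), ∀ i ≤ n, face i z.1 = c.1 := by
    obtain ⟨z, hz, h⟩ := exists_filling c.2.1 c.2.2
    exact ⟨⟨z, hz, fun i hi i' hi' => by rw [h i (by omega), h i' (by omega)]⟩, h⟩
  choose step hstep using hstep
  let c (n : ℕ) : T n := Nat.rec ⟨Finsupp.single 0 1,
    Finsupp.single_mem_supported _ _ (fun x hx => absurd hx (by simp)), by simp⟩ step n
  exact ⟨fun n => (c n).1, rfl, fun n => (c n).2.1, fun n i hi => hstep n (c n) i hi⟩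

/-! ### Ranks in increasing tuples and the gap identity -/

theorem filter_lt_image_range {m q : ℕ} {b : ℕ → ℚ} (hb : StrictMonoOn b (Set.Iio m)) (hq : q < m) :
    ((Finset.range m).image b).filter (· < b q) = (Finset.range q).image b := by
  ext y
  simp only [Finset.mem_filter, Finset.mem_image, Finset.mem_range]
  constructor
  · rintro ⟨⟨x, hx, rfl⟩, h⟩
    exact ⟨x, (hb.lt_iff_lt (Set.mem_Iio.2 hx) (Set.mem_Iio.2 hq)).1 h, rfl⟩
  · rintro ⟨x, hx, rfl⟩
    exact ⟨⟨x, by omega, rfl⟩, hb (Set.mem_Iio.2 (by omega)) (Set.mem_Iio.2 hq) hx⟩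

theorem card_image_range {m q : ℕ} {b : ℕ → ℚ} (hb : StrictMonoOn b (Set.Iio m)) (hq : q ≤ m) :
    ((Finset.range q).image b).card = q := by
  rw [Finset.card_image_of_injOn, Finset.card_range]
  exact hb.injOn.mono fun x hx => Set.mem_Iio.2 (by have := Finset.mem_range.1 hx; omega)

theorem image_skip (a : ℕ → ℚ) {i n : ℕ} (hi : i ≤ n) :
    (Finset.range (n + 1)).image a =
      insert (a i) ((Finset.range n).image fun x => a (skip i x)) := by
  ext y
  simp only [Finset.mem_insert, Finset.mem_image, Finset.mem_range]
  constructor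
  · rintro ⟨x, hx, rfl⟩
    rcases lt_trichotomy x i with h | rfl | h
    · exact Or.inr ⟨x, by omega, by rw [skip, if_pos h]⟩
    · exact Or.inl rfl
    · exact Or.inr ⟨x - 1, by omega, by rw [skip, if_neg (by omega)]; congr 1; omega⟩
  · rintro (rfl | ⟨x, hx, rfl⟩)
    · exact ⟨i, by omega, rfl⟩
    · exact ⟨skip i x, by unfold skip; split_ifs <;> omega, rfl⟩

theorem notMem_image_skip {a : ℕ → ℚ} {i n : ℕ} (ha : StrictMonoOn a (Set.Iio (n + 1)))
    (hi : i ≤ n) : a i ∉ (Finset.range n).image fun x => a (skip i x) := by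
  simp only [Finset.mem_image, Finset.mem_range, not_exists, not_and]
  intro x hx h
  have := ha.injOn (Set.mem_Iio.2 (by unfold skip; split_ifs <;> omega))
    (Set.mem_Iio.2 (by omega)) h
  unfold skip at this
  split_ifs at this <;> omega

/-- As `L` lies below `U`, it consists of the first `L.card` remaining terms, so the omitted term
sits in the gap. -/
theorem lt_of_image_skip_eq {a : ℕ → ℚ} {n : ℕ} (ha : StrictMonoOn a (Set.Iio (n + 1)))
    {L U : Finset ℚ} (hLU : ∀ l ∈ L, ∀ u ∈ U, l < u) (hn : L.card ≤ n)
    (h : ((Finset.range n).image fun x => a (skip L.card x)) = L ∪ U) :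
    (∀ l ∈ L, l < a L.card) ∧ ∀ u ∈ U, a L.card < u := by
  set b : ℕ → ℚ := fun x => a (skip L.card x) with hbdef
  have hb : StrictMonoOn b (Set.Iio n) := fun x hx y hy hxy => by
    refine ha ?_ ?_ ?_ <;> simp only [Set.mem_Iio, skip] at * <;> split_ifs <;> omega
  constructor
  · intro l hl
    obtain ⟨q, hq, rfl⟩ := Finset.mem_image.1 (h ▸ Finset.mem_union_left U hl)
    rw [Finset.mem_range] at hq
    have hsub : insert (b q) ((Finset.range q).image b) ⊆ L := by
      rw [← filter_lt_image_range hb hq, h]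
      refine Finset.insert_subset hl fun y hy => ?_
      rw [Finset.mem_filter, Finset.mem_union] at hy
      exact hy.1.resolve_right fun hy' => (hLU _ hl _ hy').not_gt hy.2
    have := Finset.card_le_card hsub
    rw [Finset.card_insert_of_notMem, card_image_range hb hq.le] at this
    · have hs : b q = a q := by simp only [hbdef, skip]; rw [if_pos (by omega)]
      rw [hs]
      exact ha (Set.mem_Iio.2 (by omega)) (Set.mem_Iio.2 (by omega)) (by omega)
    · rw [← filter_lt_image_range hb hq]
      simp
  · intro u hu
    obtain ⟨q, hq, rfl⟩ := Finset.mem_image.1 (h ▸ Finset.mem_union_right L hu)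
    rw [Finset.mem_range] at hq
    have hsub : L ⊆ (Finset.range q).image b := by
      rw [← filter_lt_image_range hb hq, h]
      exact fun l hl => Finset.mem_filter.2 ⟨Finset.mem_union_left _ hl, hLU l hl _ hu⟩
    have := Finset.card_le_card hsub
    rw [card_image_range hb hq.le] at this
    have hs : b q = a (q + 1) := by simp only [hbdef, skip]; rw [if_neg (by omega)]
    rw [hs]
    exact ha (Set.mem_Iio.2 (by omega)) (Set.mem_Iio.2 (by omega)) (by omega)

theorem image_eq_insert_iff {a : ℕ → ℚ} {n : ℕ} (ha : StrictMonoOn a (Set.Iio (n + 1)))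
    {L U : Finset ℚ} (hn : L.card ≤ n) {x : ℚ} (hL : ∀ l ∈ L, l < x)
    (hU : ∀ u ∈ U, x < u) : (Finset.range (n + 1)).image a = insert x (L ∪ U) ↔
      x = a L.card ∧ ((Finset.range n).image fun y => a (skip L.card y)) = L ∪ U := by
  have hx : x ∉ L ∪ U := fun h => by
    rcases Finset.mem_union.1 h with h | h
    · exact (hL x h).false
    · exact (hU x h).false
  constructor
  · intro h
    obtain ⟨p, hp, rfl⟩ := Finset.mem_image.1 (h ▸ Finset.mem_insert_self x (L ∪ U))
    rw [Finset.mem_range] at hp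
    have hfil := filter_lt_image_range ha hp
    have hL' : (insert (a p) (L ∪ U)).filter (· < a p) = L := by
      ext y
      simp only [Finset.mem_filter, Finset.mem_insert, Finset.mem_union]
      constructor
      · rintro ⟨rfl | hy | hy, hlt⟩
        · exact absurd hlt (lt_irrefl _)
        · exact hy
        · exact absurd hlt (hU y hy).not_gt
      · exact fun hy => ⟨Or.inr (Or.inl hy), hL y hy⟩
    rw [h, hL'] at hfil
    have hcard := congrArg Finset.card hfil
    rw [card_image_range ha hp.le] at hcard
    refine ⟨by rw [hcard], ?_⟩
    rw [image_skip a hn, ← hcard] at h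
    rw [← hcard] at hx
    have h2 := congrArg (fun s => Finset.erase s (a L.card)) h
    rwa [Finset.erase_insert (notMem_image_skip ha hn), Finset.erase_insert hx] at h2
  · rintro ⟨rfl, h⟩
    rw [image_skip a hn, h]

/-- There is a signed measure on finite subsets of the line in which the gaps of a
finite set have measure one. -/
theorem exists_gap_measure : ∃ C : Finset ℚ → ℤ, C ∅ = 1 ∧ ∀ k : ℕ, ∃ F : Finset ℚ,
    ∀ L U : Finset ℚ, (∀ l ∈ L, ∀ u ∈ U, l < u) → (L ∪ U).card ≤ k →
      ∑ x ∈ F.filter (fun x => (∀ l ∈ L, l < x) ∧ ∀ u ∈ U, x < u), C (insert x (L ∪ U)) =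
        C (L ∪ U) := by
  classical
  obtain ⟨c, hc0, hc, hface⟩ := exists_consistent_seqSum
  -- The total coefficient of the tuples that enumerate `A`.
  let C (A : Finset ℚ) : ℤ :=
    (c A.card).sum fun a r => if (Finset.range A.card).image a = A then r else 0
  have hC (A : Finset ℚ) (n : ℕ) (hn : A.card = n) :
      C A = (c n).sum fun a r => if (Finset.range n).image a = A then r else 0 := by
    subst hn; rfl
  refine ⟨C, ?_, fun k => ?_⟩
  · rw [hC ∅ 0 rfl, hc0, Finsupp.sum_single_index] <;> simp
  -- `F` collects all the terms of the tuples in `c 1, …, c (k + 1)`, so no contributing gap point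
  -- is lost.
  refine ⟨(Finset.range (k + 1)).biUnion fun n => (c (n + 1)).support.biUnion fun a =>
    (Finset.range (n + 1)).image a, fun L U hLU hk => ?_⟩
  set F := (Finset.range (k + 1)).biUnion fun n => (c (n + 1)).support.biUnion fun a =>
    (Finset.range (n + 1)).image a with hF
  obtain ⟨n, hn⟩ : ∃ n, (L ∪ U).card = n := ⟨_, rfl⟩
  have hLn : L.card ≤ n := hn ▸ Finset.card_le_card Finset.subset_union_left
  have hins : ∀ x ∈ F.filter (fun x => (∀ l ∈ L, l < x) ∧ ∀ u ∈ U, x < u),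
      C (insert x (L ∪ U)) = (c (n + 1)).sum fun a r =>
        if x = a L.card ∧ ((Finset.range n).image fun y => a (skip L.card y)) = L ∪ U
          then r else 0 := by
    intro x hx
    obtain ⟨-, hL, hU⟩ := Finset.mem_filter.1 hx
    have hx : x ∉ L ∪ U := fun h => by
      rcases Finset.mem_union.1 h with h | h
      · exact (hL x h).false
      · exact (hU x h).false
    rw [hC _ (n + 1) (by rw [Finset.card_insert_of_notMem hx, hn])]
    refine Finset.sum_congr rfl fun a ha => ?_
    exact if_congr (image_eq_insert_iff (hc _ ha) hLn hL hU) rfl rfl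
  -- A point in the gap has rank `L.card`, so the claim compares coefficients in `face L.card (c (n
  -- + 1)) = c n`.
  rw [Finset.sum_congr rfl hins, hC _ n hn, ← hface n L.card hLn]
  unfold face
  rw [Finsupp.lmapDomain_apply, Finsupp.sum_mapDomain_index (by simp)
    (by intros; split_ifs <;> simp)]
  unfold Finsupp.sum
  rw [Finset.sum_comm]
  refine Finset.sum_congr rfl fun a ha => ?_
  by_cases h : ((Finset.range n).image fun y => a (skip L.card y)) = L ∪ U
  · simp only [h, and_true, if_true]
    rw [Finset.sum_ite_eq', if_pos]
    refine Finset.mem_filter.2 ⟨?_, lt_of_image_skip_eq (hc _ ha) hLU hLn h⟩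
    refine Finset.mem_biUnion.2 ⟨n, Finset.mem_range.2 (by omega), Finset.mem_biUnion.2 ⟨a, ha, ?_⟩⟩
    exact Finset.mem_image_of_mem _ (Finset.mem_range.2 (by omega))
  · simp [h]

end IncreasingTuples

/-! ### Signed sums of injections into a finite set of labels and gap points -/

section Coefficients

open scoped Classical

variable {ℓ : ℕ}

/-- The set of labels (in two copies) and of the points of `F`. -/
abbrev Target (ℓ : ℕ) (F : Finset ℚ) : Type := (Fin ℓ × Bool) ⊕ F

/-- `g` has the same labels as `φ`, up to the choice of a copy, and orders the remaining points in
the same way. -/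
structure Compat {F : Finset ℚ} {X : Type} (φ : X → Fin ℓ ⊕ ℝ) (g : X → Target ℓ F) : Prop where
  left : ∀ s i, φ s = Sum.inl i → ∃ b, g s = Sum.inl (i, b)
  right : ∀ s r, φ s = Sum.inr r → ∃ q, g s = Sum.inr q
  mono : ∀ s s' r r' q q', φ s = Sum.inr r → φ s' = Sum.inr r' → r < r' → g s = Sum.inr q →
    g s' = Sum.inr q' → q.1 < q'.1

/-- The weight of an element of the target. -/
def labelWeight {F : Finset ℚ} (wt : Bool → ℤ) : Target ℓ F → ℤ :=
  Sum.elim (fun p => wt p.2) fun _ => 1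

/-- The set of points of `F` in the image of `g`. -/
def pointImage {F : Finset ℚ} {X : Type} [Fintype X] (g : X → Target ℓ F) : Finset ℚ :=
  Finset.univ.biUnion fun s => Sum.elim (fun _ => ∅) (fun q => {q.1}) (g s)

theorem mem_pointImage {F : Finset ℚ} {X : Type} [Fintype X] {g : X → Target ℓ F} {q : ℚ} :
    q ∈ pointImage g ↔ ∃ s x, g s = Sum.inr x ∧ x.1 = q := by
  simp only [pointImage, Finset.mem_biUnion, Finset.mem_univ, true_and]
  refine exists_congr fun s => ?_
  rcases g s with p | x
  · simp
  · simp [eq_comm]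

theorem card_pointImage_le {F : Finset ℚ} {X : Type} [Fintype X] (g : X → Target ℓ F) :
    (pointImage g).card ≤ Fintype.card X := by
  refine (Finset.card_biUnion_le_card_mul _ _ 1 fun s _ => ?_).trans (by simp)
  rcases g s with p | x <;> simp

/-- The coefficient of `g` in the signed sum of maps attached to `φ`. -/
def coef {F : Finset ℚ} (C : Finset ℚ → ℤ) (wt : Bool → ℤ) {X : Type} [Fintype X]
    (φ : X → Fin ℓ ⊕ ℝ) (g : X → Target ℓ F) : ℤ :=
  if Compat φ g then (∏ s, labelWeight wt (g s)) * C (pointImage g) else 0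

/-- The total weight of the copies of a label, or one for a point of the line. -/
def totalWeight (wt : Bool → ℤ) : Fin ℓ ⊕ ℝ → ℤ :=
  Sum.elim (fun _ => wt false + wt true) fun _ => 1

theorem Compat.comp {F : Finset ℚ} {X Y : Type} {φ : Y → Fin ℓ ⊕ ℝ} {g : Y → Target ℓ F}
    (h : Compat φ g) (f : X → Y) : Compat (φ ∘ f) (g ∘ f) where
  left s := h.left (f s)
  right s := h.right (f s)
  mono s s' := h.mono (f s) (f s')

/-- This allows sums over injections to be replaced by sums over all maps, which can be summed out
pointwise. -/
theorem Compat.injective {F : Finset ℚ} {X : Type} {φ : X → Fin ℓ ⊕ ℝ} {g : X → Target ℓ F}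
    (h : Compat φ g) (hφ : Function.Injective φ) : Function.Injective g := by
  intro s s' hs
  rcases hi : φ s with i | r <;> rcases hi' : φ s' with i' | r'
  · obtain ⟨b, hb⟩ := h.left s i hi
    obtain ⟨b', hb'⟩ := h.left s' i' hi'
    rw [hb, hb', Sum.inl.injEq, Prod.mk.injEq] at hs
    exact hφ (by rw [hi, hi', hs.1])
  · obtain ⟨b, hb⟩ := h.left s i hi
    obtain ⟨q, hq⟩ := h.right s' r' hi'
    rw [hb, hq] at hs
    cases hs
  · obtain ⟨b, hb⟩ := h.left s' i' hi'
    obtain ⟨q, hq⟩ := h.right s r hi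
    rw [hb, hq] at hs
    cases hs
  · obtain ⟨q, hq⟩ := h.right s r hi
    obtain ⟨q', hq'⟩ := h.right s' r' hi'
    have hqq : q = q' := by rwa [hq, hq', Sum.inr.injEq] at hs
    rcases lt_trichotomy r r' with hr | rfl | hr
    · exact absurd (h.mono s s' r r' q q' hi hi' hr hq hq') (by rw [hqq]; exact lt_irrefl _)
    · exact hφ (hi.trans hi'.symm)
    · exact absurd (h.mono s' s r' r q' q hi' hi hr hq' hq) (by rw [hqq]; exact lt_irrefl _)

theorem coef_comp_equiv {F : Finset ℚ} (C : Finset ℚ → ℤ) (wt : Bool → ℤ) {X Y : Type} [Fintype X]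
    [Fintype Y] (e : X ≃ Y) (φ : Y → Fin ℓ ⊕ ℝ) (g : Y → Target ℓ F) :
    coef C wt (φ ∘ e) (g ∘ e) = coef C wt φ g := by
  have h1 : Compat (φ ∘ e) (g ∘ e) ↔ Compat φ g :=
    ⟨fun h => by simpa [Function.comp_assoc] using h.comp e.symm, fun h => h.comp e⟩
  have h2 : pointImage (g ∘ e) = pointImage g := by
    ext q
    rw [mem_pointImage, mem_pointImage, ← e.exists_congr_right]
    rfl
  unfold coef
  rw [h2, ← e.prod_comp]
  simp only [h1, Function.comp_apply]

/-- The extension of a map by a value at the additional point. -/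
def extend {F : Finset ℚ} {X : Type} (g : X → Target ℓ F) (w : Target ℓ F) (o : Option X) :
    Target ℓ F := o.elim w g

theorem pointImage_extend_inl {F : Finset ℚ} {X : Type} [Fintype X] (g : X → Target ℓ F)
    (p : Fin ℓ × Bool) : pointImage (extend g (Sum.inl p)) = pointImage g := by
  ext q
  simp [mem_pointImage, Option.exists, extend]

theorem pointImage_extend_inr {F : Finset ℚ} {X : Type} [Fintype X] (g : X → Target ℓ F)
    (x : F) : pointImage (extend g (Sum.inr x)) = insert x.1 (pointImage g) := by
  ext q
  simp [mem_pointImage, Option.exists, extend, eq_comm]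

theorem prod_labelWeight_extend {F : Finset ℚ} {X : Type} [Fintype X] (wt : Bool → ℤ)
    (g : X → Target ℓ F) (w : Target ℓ F) : ∏ o, labelWeight wt (extend g w o) =
      labelWeight wt w * ∏ s, labelWeight wt (g s) := by
  rw [Fintype.prod_option]
  rfl

theorem compat_extend_inl_iff {F : Finset ℚ} {X : Type} {φ : Option X → Fin ℓ ⊕ ℝ} {i : Fin ℓ}
    (hi : φ none = Sum.inl i) (g : X → Target ℓ F) (w : Target ℓ F) :
    Compat φ (extend g w) ↔ (∃ b, w = Sum.inl (i, b)) ∧ Compat (φ ∘ some) g := by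
  constructor
  · exact fun h => ⟨h.left none i hi, h.comp some⟩
  · rintro ⟨⟨b, rfl⟩, h⟩
    refine ⟨fun s j hj => ?_, fun s r hr => ?_, fun s s' r r' q q' hr hr' => ?_⟩
    · cases s with
      | none => rw [hi, Sum.inl.injEq] at hj; exact ⟨b, by rw [← hj]; rfl⟩
      | some s => exact h.left s j hj
    · cases s with
      | none => rw [hi] at hr; cases hr
      | some s => exact h.right s r hr
    · cases s with
      | none => rw [hi] at hr; cases hr
      | some s =>
        cases s' with
        | none => rw [hi] at hr'; cases hr'
        | some s' => exact h.mono s s' r r' q q' hr hr'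

theorem compat_extend_inr_iff {F : Finset ℚ} {X : Type} {φ : Option X → Fin ℓ ⊕ ℝ} {r : ℝ}
    (hr : φ none = Sum.inr r) (g : X → Target ℓ F) (x : F) :
    Compat φ (extend g (Sum.inr x)) ↔ ((∀ s r' y, φ (some s) = Sum.inr r' → r' < r →
        g s = Sum.inr y → y.1 < x.1) ∧ (∀ s r' y, φ (some s) = Sum.inr r' → r < r' →
        g s = Sum.inr y → x.1 < y.1)) ∧ Compat (φ ∘ some) g := by
  constructor
  · exact fun h => ⟨⟨fun s r' y hs hlt hy => h.mono (some s) none r' r y x hs hr hlt hy rfl,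
      fun s r' y hs hlt hy => h.mono none (some s) r r' x y hr hs hlt rfl hy⟩, h.comp some⟩
  · rintro ⟨⟨h1, h2⟩, h⟩
    refine ⟨fun s j hj => ?_, fun s r hr => ?_, fun s s' t t' q q' ht ht' hlt hq hq' => ?_⟩
    · cases s with
      | none => rw [hr] at hj; cases hj
      | some s => exact h.left s j hj
    · cases s with
      | none => exact ⟨x, rfl⟩
      | some s => exact h.right s r hr
    · cases s with
      | none =>
        obtain rfl : x = q := Sum.inr.inj hq
        obtain rfl : r = t := Sum.inr.inj (hr.symm.trans ht)
        cases s' with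
        | none => exact absurd hlt (by
            obtain rfl : r = t' := Sum.inr.inj (hr.symm.trans ht')
            exact lt_irrefl _)
        | some s' => exact h2 s' t' q' ht' hlt hq'
      | some s =>
        cases s' with
        | none =>
          obtain rfl : x = q' := Sum.inr.inj hq'
          obtain rfl : r = t' := Sum.inr.inj (hr.symm.trans ht')
          exact h1 s t q ht hlt hq
        | some s' => exact h.mono s s' t t' q q' ht ht' hlt hq hq'

/-- The gaps of sets with at most `k` elements have measure one. -/
def GapSum (C : Finset ℚ → ℤ) (k : ℕ) (F : Finset ℚ) : Prop :=
  ∀ L U : Finset ℚ, (∀ l ∈ L, ∀ u ∈ U, l < u) → (L ∪ U).card ≤ k →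
    ∑ x ∈ F.filter (fun x => (∀ l ∈ L, l < x) ∧ ∀ u ∈ U, x < u), C (insert x (L ∪ U)) = C (L ∪ U)

/-- With `L` and `U` the values of `g` at points below and above `r`, the compatible values at the
new point are exactly those in the gap. -/
theorem sum_gap {C : Finset ℚ → ℤ} {k : ℕ} {F : Finset ℚ} (hgap : GapSum C k F) {X : Type}
    [Fintype X] (hX : Fintype.card X ≤ k) {φ : Option X → Fin ℓ ⊕ ℝ} (hφ : Function.Injective φ)
    {r : ℝ} (hr : φ none = Sum.inr r) {g : X → Target ℓ F} (hg : Compat (φ ∘ some) g) :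
    ∑ x : F, (if Compat φ (extend g (Sum.inr x)) then C (insert x.1 (pointImage g)) else 0) =
      C (pointImage g) := by
  let L := (pointImage g).filter fun q => ∃ s r' y, φ (some s) = Sum.inr r' ∧ r' < r ∧
    g s = Sum.inr y ∧ y.1 = q
  let U := (pointImage g).filter fun q => ∃ s r' y, φ (some s) = Sum.inr r' ∧ r < r' ∧
    g s = Sum.inr y ∧ y.1 = q
  have hL (q : ℚ) : q ∈ L ↔ ∃ s r' y, φ (some s) = Sum.inr r' ∧ r' < r ∧
      g s = Sum.inr y ∧ y.1 = q := by
    refine Finset.mem_filter.trans ⟨And.right, fun h => ⟨?_, h⟩⟩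
    obtain ⟨s, r', y, -, -, h⟩ := h
    exact mem_pointImage.2 ⟨s, y, h⟩
  have hU (q : ℚ) : q ∈ U ↔ ∃ s r' y, φ (some s) = Sum.inr r' ∧ r < r' ∧
      g s = Sum.inr y ∧ y.1 = q := by
    refine Finset.mem_filter.trans ⟨And.right, fun h => ⟨?_, h⟩⟩
    obtain ⟨s, r', y, -, -, h⟩ := h
    exact mem_pointImage.2 ⟨s, y, h⟩
  have hLU : L ∪ U = pointImage g := by
    refine Finset.Subset.antisymm (Finset.union_subset (Finset.filter_subset _ _)
      (Finset.filter_subset _ _)) fun q hq => ?_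
    obtain ⟨s, x, hs, rfl⟩ := mem_pointImage.1 hq
    rw [Finset.mem_union, hL, hU]
    rcases hs' : φ (some s) with i | r'
    · obtain ⟨b, hb⟩ := hg.left s i hs'
      rw [hs] at hb
      cases hb
    · rcases lt_trichotomy r' r with h | rfl | h
      · exact Or.inl ⟨s, r', x, hs', h, hs, rfl⟩
      · exact absurd (hφ (hs'.trans hr.symm)) (by simp)
      · exact Or.inr ⟨s, r', x, hs', h, hs, rfl⟩
  have key := hgap L U (fun l hl u hu => by
    obtain ⟨s, r₁, y, h1, h2, h3, rfl⟩ := (hL l).1 hl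
    obtain ⟨s', r₂, y', h1', h2', h3', rfl⟩ := (hU u).1 hu
    exact hg.mono s s' r₁ r₂ y y' h1 h1' (h2.trans h2') h3 h3')
    (by rw [hLU]; exact (card_pointImage_le g).trans hX)
  rw [hLU, Finset.sum_filter, ← Finset.sum_coe_sort] at key
  refine Eq.trans (Finset.sum_congr rfl fun x _ => if_congr ?_ rfl rfl) key
  rw [compat_extend_inr_iff hr, and_iff_left hg]
  refine and_congr ⟨fun h l hl => ?_, fun h s r' y h1 h2 h3 => h _ ((hL _).2
    ⟨s, r', y, h1, h2, h3, rfl⟩)⟩ ⟨fun h l hl => ?_, fun h s r' y h1 h2 h3 => h _ ((hU _).2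
    ⟨s, r', y, h1, h2, h3, rfl⟩)⟩
  · obtain ⟨s, r', y, h1, h2, h3, rfl⟩ := (hL l).1 hl
    exact h s r' y h1 h2 h3
  · obtain ⟨s, r', y, h1, h2, h3, rfl⟩ := (hU l).1 hl
    exact h s r' y h1 h2 h3

theorem sum_coef_extend {C : Finset ℚ → ℤ} {k : ℕ} {F : Finset ℚ} (hgap : GapSum C k F)
    (wt : Bool → ℤ) {X : Type} [Fintype X] (hX : Fintype.card X ≤ k) {φ : Option X → Fin ℓ ⊕ ℝ}
    (hφ : Function.Injective φ) (g : X → Target ℓ F) :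
    ∑ w, coef C wt φ (extend g w) = totalWeight wt (φ none) * coef C wt (φ ∘ some) g := by
  by_cases hg : Compat (φ ∘ some) g
  swap
  · unfold coef
    rw [if_neg hg, mul_zero]
    exact Finset.sum_eq_zero fun w _ => if_neg fun h => hg (h.comp some)
  rw [Fintype.sum_sum_type]
  unfold coef
  simp only [prod_labelWeight_extend, pointImage_extend_inl, pointImage_extend_inr, if_pos hg]
  rcases h : φ none with i | r
  · simp only [compat_extend_inl_iff h, reduceCtorEq, exists_const, if_false, hg,
      and_true, Finset.sum_const_zero, add_zero, Sum.inl.injEq, Fintype.sum_prod_type,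
      Prod.mk.injEq, Fintype.sum_bool, totalWeight, Sum.elim_inl, labelWeight]
    rw [Finset.sum_eq_single i]
    · simp
      ring
    · intro j _ hj
      simp [hj]
    · simp
  · have hinl : ∀ p, ¬ Compat φ (extend g (Sum.inl p)) := fun p hp => by
      obtain ⟨q, hq⟩ := hp.right none r h
      cases hq
    simp only [hinl, if_false, Finset.sum_const_zero, zero_add, totalWeight, Sum.elim_inr, one_mul,
      labelWeight]
    rw [← sum_gap hgap hX hφ h hg, Finset.mul_sum]
    exact Finset.sum_congr rfl fun x _ => by split_ifs <;> simp

theorem sum_coef_sumElim {C : Finset ℚ → ℤ} {k : ℕ} {F : Finset ℚ} (hgap : GapSum C k F)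
    (wt : Bool → ℤ) {X : Type} [Fintype X] (g : X → Target ℓ F)
    (E : Type) [Fintype E] :
    Fintype.card X + Fintype.card E ≤ k → ∀ φ : X ⊕ E → Fin ℓ ⊕ ℝ, Function.Injective φ →
    ∑ h : E → Target ℓ F, coef C wt φ (Sum.elim g h) =
      (∏ e, totalWeight wt (φ (Sum.inr e))) * coef C wt (φ ∘ Sum.inl) g := by
  refine Fintype.induction_empty_option (P := fun E _ => Fintype.card X + Fintype.card E ≤ k →
    ∀ φ : X ⊕ E → Fin ℓ ⊕ ℝ, Function.Injective φ → ∑ h : E → Target ℓ F,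
      coef C wt φ (Sum.elim g h) = (∏ e, totalWeight wt (φ (Sum.inr e))) *
        coef C wt (φ ∘ Sum.inl) g) ?_ ?_ ?_ E
  · intro E E' _ e ih hE φ hφ
    let := Fintype.ofEquiv E' e.symm
    have := ih (by rwa [Fintype.card_congr e]) (φ ∘ Sum.map id e)
      (hφ.comp (Function.injective_id.sumMap e.injective))
    rw [← e.prod_comp]
    refine Eq.trans ?_ this
    refine Fintype.sum_equiv (e.arrowCongr (Equiv.refl _)).symm _ _ fun h => ?_
    rw [← coef_comp_equiv C wt (Equiv.sumCongr (Equiv.refl X) e)]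
    congr 1
    funext s
    rcases s with s | s <;> rfl
  · intro _ φ _
    rw [Fintype.sum_unique, Fintype.prod_empty, one_mul,
      ← coef_comp_equiv C wt (Equiv.sumEmpty X PEmpty).symm]
    rfl
  · intro E _ ih hE φ hφ
    let e : Option (X ⊕ E) ≃ X ⊕ Option E :=
      { toFun := fun o => o.elim (Sum.inr none) (Sum.map id some)
        invFun := Sum.elim (fun s => some (Sum.inl s)) fun o => o.elim none fun s => some (Sum.inr s)
        left_inv := by rintro (_ | _ | _) <;> rfl
        right_inv := by rintro (_ | _ | _) <;> rfl }
    rw [Fintype.card_option] at hE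
    have h1 (w : Target ℓ F) (h : E → Target ℓ F) :
        coef C wt φ (Sum.elim g (extend h w)) = coef C wt (φ ∘ e) (extend (Sum.elim g h) w) := by
      rw [← coef_comp_equiv C wt e]
      congr 1
      funext s
      rcases s with _ | _ | _ <;> rfl
    have h2 : ∑ h : Option E → Target ℓ F, coef C wt φ (Sum.elim g h) =
        ∑ h : E → Target ℓ F, ∑ w, coef C wt φ (Sum.elim g (extend h w)) := by
      rw [← Fintype.sum_prod_type']
      refine Fintype.sum_equiv ((Equiv.piOptionEquivProd (β := fun _ => Target ℓ F)).trans
        (Equiv.prodComm _ _)) _ _ fun h => ?_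
      congr 2
      funext o
      cases o <;> rfl
    refine Eq.trans (by congr!) (h2.trans ?_)
    simp only [h1]
    simp only [sum_coef_extend hgap wt (X := X ⊕ E) (by rw [Fintype.card_sum]; omega)
      (hφ.comp e.injective)]
    rw [← Finset.mul_sum]
    have h3 := ih (by omega) (φ ∘ e ∘ some)
      (hφ.comp (e.injective.comp (Option.some_injective _)))
    rw [Fintype.prod_option, mul_assoc]
    congr 1

/-- Points outside the image of `f` are summed out one by one, each leaving its total weight. -/
theorem sum_coef_comp {C : Finset ℚ → ℤ} {k : ℕ} {F : Finset ℚ} (hgap : GapSum C k F)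
    (wt : Bool → ℤ) {X Y : Type} [Fintype X] [Fintype Y] (hY : Fintype.card Y ≤ k) (f : X ↪ Y)
    {φ : Y → Fin ℓ ⊕ ℝ} (hφ : Function.Injective φ) (g' : X → Target ℓ F) :
    ∑ g : Y → Target ℓ F, (if g ∘ f = g' then coef C wt φ g else 0) =
      (∏ y : ↥(Set.range f)ᶜ, totalWeight wt (φ y)) * coef C wt (φ ∘ f) g' := by
  let E := ↥(Set.range f)ᶜ
  let e : X ⊕ E ≃ Y := ((Equiv.ofInjective f f.injective).sumCongr (Equiv.refl _)).trans
    (Equiv.Set.sumCompl _)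
  have hcard : Fintype.card X + Fintype.card E ≤ k := by
    rwa [← Fintype.card_sum, Fintype.card_congr e]
  have key := sum_coef_sumElim hgap wt g' E hcard _ (hφ.comp e.injective)
  refine Eq.trans ?_ key
  have h1 : ∑ g : Y → Target ℓ F, (if g ∘ f = g' then coef C wt φ g else 0) =
      ∑ g : X → Target ℓ F, ∑ h : E → Target ℓ F,
        (if g = g' then coef C wt (φ ∘ e) (Sum.elim g h) else 0) := by
    rw [← Fintype.sum_prod_type']
    refine Fintype.sum_equiv ((e.arrowCongr (Equiv.refl _)).symm.trans
      (Equiv.sumArrowEquivProdArrow _ _ _)) _ _ fun g => ?_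
    rw [← coef_comp_equiv C wt e φ g]
    refine if_congr Iff.rfl ?_ rfl
    congr 1
    funext s
    rcases s with s | s <;> rfl
  rw [h1, Finset.sum_eq_single g']
  · simp only [if_true]
    congr!
  · intro g _ hg
    simp [hg]
  · simp

end Coefficients

/-! ### Embeddings of the same type -/

section Topology

open Filter Topology

variable {ℓ : ℕ}

/-- `ψ` has the same labels as `φ` and orders the remaining points in the same way. -/
structure SameType {X : Type} (φ ψ : X → Fin ℓ ⊕ ℝ) : Prop where
  left : ∀ s i, φ s = Sum.inl i → ψ s = Sum.inl i
  right : ∀ s r, φ s = Sum.inr r → ∃ x, ψ s = Sum.inr x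
  mono : ∀ s s' r r' x x', φ s = Sum.inr r → φ s' = Sum.inr r' → r < r' → ψ s = Sum.inr x →
    ψ s' = Sum.inr x' → x < x'

theorem SameType.symm {X : Type} {φ ψ : X → Fin ℓ ⊕ ℝ} (h : SameType φ ψ)
    (hφ : Function.Injective φ) : SameType ψ φ where
  left s i hi := by
    rcases hs : φ s with j | r
    · rw [← h.left s j hs, hi]
    · obtain ⟨x, hx⟩ := h.right s r hs
      rw [hi] at hx
      cases hx
  right s x hx := by
    rcases hs : φ s with j | r
    · rw [h.left s j hs] at hx
      cases hx
    · exact ⟨r, rfl⟩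
  mono s s' x x' r r' hx hx' hlt hr hr' := by
    rcases lt_trichotomy r r' with h' | rfl | h'
    · exact h'
    · obtain rfl := hφ (hr.trans hr'.symm)
      obtain rfl : x = x' := Sum.inr.inj (hx.symm.trans hx')
      exact absurd hlt (lt_irrefl _)
    · exact absurd hlt (h.mono s' s r' r x' x hr' hr h' hx' hx).not_gt

theorem SameType.compat {X : Type} {F : Finset ℚ} {φ ψ : X → Fin ℓ ⊕ ℝ} (h : SameType φ ψ)
    {g : X → Target ℓ F} (hg : Compat ψ g) : Compat φ g where
  left s i hi := hg.left s i (h.left s i hi)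
  right s r hr := by
    obtain ⟨x, hx⟩ := h.right s r hr
    exact hg.right s x hx
  mono s s' r r' q q' hr hr' hlt hq hq' := by
    obtain ⟨x, hx⟩ := h.right s r hr
    obtain ⟨x', hx'⟩ := h.right s' r' hr'
    exact hg.mono s s' x x' q q' hx hx' (h.mono s s' r r' x x' hr hr' hlt hx hx') hq hq'

theorem SameType.coef_eq {X : Type} [Fintype X] {F : Finset ℚ} {φ ψ : X → Fin ℓ ⊕ ℝ}
    (h : SameType φ ψ) (hφ : Function.Injective φ) (C : Finset ℚ → ℤ) (wt : Bool → ℤ)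
    (g : X → Target ℓ F) : coef C wt φ g = coef C wt ψ g := by
  have : Compat φ g ↔ Compat ψ g := ⟨(h.symm hφ).compat, h.compat⟩
  classical exact if_congr this rfl rfl

/-- The labels in the image depend only on the type. -/
theorem SameType.range_subset {X : Type} {φ ψ : X → Fin ℓ ⊕ ℝ} (h : SameType φ ψ)
    (hφ : Set.range Sum.inl ⊆ Set.range φ) : Set.range Sum.inl ⊆ Set.range ψ := by
  rintro _ ⟨i, rfl⟩
  obtain ⟨s, hs⟩ := hφ ⟨i, rfl⟩
  exact ⟨s, h.left s i hs⟩

theorem continuous_realPart : Continuous (Sum.elim (fun _ => 0) id : Fin ℓ ⊕ ℝ → ℝ) :=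
  continuous_const.sumElim continuous_id

/-- Each label is an isolated point, the line is open, and strict inequalities are open conditions.
-/
theorem eventually_sameType {S : FI} (φ : EmbSpace ℓ S) :
    ∀ᶠ ψ : EmbSpace ℓ S in 𝓝 φ, SameType φ.1 ψ.1 := by
  have := S.finite
  have hev (s : S.carrier) : Continuous fun ψ : EmbSpace ℓ S => ψ.1 s :=
    (continuous_apply s).comp continuous_subtype_val
  have h1 : ∀ᶠ ψ : EmbSpace ℓ S in 𝓝 φ, ∀ s, ∀ i, φ.1 s = Sum.inl i → ψ.1 s = Sum.inl i := by
    refine eventually_all.2 fun s => eventually_all.2 fun i => eventually_imp_distrib_left.2 ?_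
    intro hi
    have hopen : IsOpen ({Sum.inl i} : Set (Fin ℓ ⊕ ℝ)) := by
      rw [← Set.image_singleton]
      exact Topology.IsOpenEmbedding.inl.isOpenMap _ (isOpen_discrete _)
    exact (hev s).continuousAt.eventually_mem (hopen.mem_nhds hi)
  have h2 : ∀ᶠ ψ : EmbSpace ℓ S in 𝓝 φ, ∀ s, φ.1 s ∈ Set.range Sum.inr →
      ψ.1 s ∈ Set.range (Sum.inr : ℝ → Fin ℓ ⊕ ℝ) := by
    refine eventually_all.2 fun s => eventually_imp_distrib_left.2 fun hs => ?_
    exact (hev s).continuousAt.eventually_mem (isOpen_range_inr.mem_nhds hs)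
  have h3 : ∀ᶠ ψ : EmbSpace ℓ S in 𝓝 φ, ∀ s s',
      Sum.elim (fun _ => 0) id (φ.1 s) < (Sum.elim (fun _ => 0) id (φ.1 s') : ℝ) →
      Sum.elim (fun _ => 0) id (ψ.1 s) < (Sum.elim (fun _ => 0) id (ψ.1 s') : ℝ) := by
    refine eventually_all.2 fun s => eventually_all.2 fun s' => eventually_imp_distrib_left.2 ?_
    exact fun hs => (continuous_realPart.comp (hev s)).continuousAt.eventually_lt
      (continuous_realPart.comp (hev s')).continuousAt hs
  filter_upwards [h1, h2, h3] with ψ h1 h2 h3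
  refine ⟨h1, fun s r hr => ?_, fun s s' r r' x x' hr hr' hlt hx hx' => ?_⟩
  · obtain ⟨x, hx⟩ := h2 s ⟨r, hr.symm⟩
    exact ⟨x, hx.symm⟩
  · have := h3 s s'
    rw [hr, hr', hx, hx'] at this
    exact this hlt

theorem eq_of_joined {B : Type*} {S : FI} (G : EmbSpace ℓ S → B)
    (hG : ∀ φ ψ : EmbSpace ℓ S, SameType φ.1 ψ.1 → G ψ = G φ) {φ ψ : EmbSpace ℓ S}
    (h : Joined φ ψ) : G φ = G ψ := by
  have hloc : IsLocallyConstant G := (IsLocallyConstant.iff_eventually_eq G).2 fun φ =>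
    (eventually_sameType φ).mono fun ψ => hG φ ψ
  obtain ⟨γ⟩ := h
  have := (hloc.comp_continuous γ.continuous).apply_eq_of_preconnectedSpace 0 1
  simpa using this

/-- Interpolation between two points of `[ℓ] ⊔ ℝ` that agree if they are labels. -/
def interpolate (t : ℝ) : Fin ℓ ⊕ ℝ → Fin ℓ ⊕ ℝ → Fin ℓ ⊕ ℝ
  | Sum.inl i, _ => Sum.inl i
  | Sum.inr r, y => Sum.inr ((1 - t) * r + t * (Sum.elim (fun _ => 0) id y : ℝ))

/-- A convex combination of two placements in the same order keeps that order. -/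
theorem SameType.interpolate_injective {X : Type} {φ ψ : X → Fin ℓ ⊕ ℝ} (h : SameType φ ψ)
    (hφ : Function.Injective φ) {t : ℝ} (h0 : 0 ≤ t) (h1 : t ≤ 1) :
    Function.Injective fun s => interpolate t (φ s) (ψ s) := by
  have hlt : ∀ s s' r r', φ s = Sum.inr r → φ s' = Sum.inr r' → r < r' →
      (1 - t) * r + t * (Sum.elim (fun _ => 0) id (ψ s) : ℝ) <
      (1 - t) * r' + t * (Sum.elim (fun _ => 0) id (ψ s') : ℝ) := by
    intro s s' r r' hr hr' hlt
    obtain ⟨x, hx⟩ := h.right s r hr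
    obtain ⟨x', hx'⟩ := h.right s' r' hr'
    have hxx := h.mono s s' r r' x x' hr hr' hlt hx hx'
    rw [hx, hx']
    simp only [Sum.elim_inr, id]
    rcases h0.lt_or_eq with h0 | rfl
    · have := mul_lt_mul_of_pos_left hxx h0
      have := mul_le_mul_of_nonneg_left hlt.le (sub_nonneg.2 h1)
      linarith
    · simpa using hlt
  intro s s' hs
  simp only at hs
  rcases hi : φ s with i | r <;> rcases hi' : φ s' with i' | r' <;>
    rw [hi, hi'] at hs <;> simp only [interpolate, reduceCtorEq, Sum.inl.injEq, Sum.inr.injEq] at hs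
  · exact hφ (by rw [hi, hi', hs])
  · rcases lt_trichotomy r r' with h' | rfl | h'
    · exact absurd hs (hlt s s' r r' hi hi' h').ne
    · exact hφ (hi.trans hi'.symm)
    · exact absurd hs (hlt s' s r' r hi' hi h').ne'

theorem SameType.joined {S : FI} {φ ψ : EmbSpace ℓ S} (h : SameType φ.1 ψ.1) : Joined φ ψ := by
  refine ⟨⟨⟨fun t => ⟨fun s => interpolate t (φ.1 s) (ψ.1 s),
    h.interpolate_injective φ.2 t.2.1 t.2.2⟩, ?_⟩, ?_, ?_⟩⟩
  · refine Continuous.subtype_mk (continuous_pi fun s => ?_) _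
    rcases φ.1 s with i | r
    · exact continuous_const
    · exact continuous_inr.comp (by fun_prop)
  · refine Subtype.ext (funext fun s => ?_)
    rcases hs : φ.1 s with i | r <;> simp [interpolate, hs]
  · refine Subtype.ext (funext fun s => ?_)
    rcases hs : φ.1 s with i | r
    · simp [interpolate, hs, h.left s i hs]
    · obtain ⟨x, hx⟩ := h.right s r hs
      simp [interpolate, hs, hx]

end Topology

/-! ### Flatness of `Ξ(ℓ)` -/

section XiFlat

variable {ℓ : ℕ}

/-- The class in `Ξ(ℓ)_S` of an embedding. -/
def xiClass {S : FI} (φ : EmbSpace ℓ S) : (Xi ℓ).obj (Opposite.op S) :=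
  pointClass ((embPair ℓ).obj (Opposite.op S)) φ

theorem xi_map_xiClass {S T : FI} (f : S ⟶ T) (φ : EmbSpace ℓ T) :
    (Xi ℓ).map f.op (xiClass φ) = xiClass (precomp ℓ f φ) :=
  pointClass_map ((embPair ℓ).map f.op) φ

theorem xiClass_eq_zero {S : FI} {φ : EmbSpace ℓ S} (h : φ ∈ missing ℓ S) : xiClass φ = 0 :=
  pointClass_eq_zero ((embPair ℓ).obj (Opposite.op S)) ⟨φ, h⟩

theorem xiClass_eq_of_sameType {S : FI} {φ ψ : EmbSpace ℓ S} (h : SameType φ.1 ψ.1) :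
    xiClass φ = xiClass ψ := pointClass_eq_of_joined h.joined

/-- The projection modulo the subgroup generated by the classes is zero on every class, hence zero.
-/
theorem xi_induction {S : FI} {P : (Xi ℓ).obj (Opposite.op S) → Prop} (cls : ∀ φ, P (xiClass φ))
    (zero : P 0) (add : ∀ x y, P x → P y → P (x + y)) (neg : ∀ x, P x → P (-x))
    (x : (Xi ℓ).obj (Opposite.op S)) : P x := by
  let H := AddSubgroup.closure (Set.range (xiClass (ℓ := ℓ) (S := S)))
  have hH : QuotientAddGroup.mk' H = 0 :=
    pointClass_hom_ext (p := (embPair ℓ).obj (Opposite.op S)) fun φ =>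
      (QuotientAddGroup.eq_zero_iff _).2 (AddSubgroup.subset_closure ⟨φ, rfl⟩)
  have hx : x ∈ H := (QuotientAddGroup.eq_zero_iff x).1 (DFunLike.congr_fun hH x)
  induction hx using AddSubgroup.closure_induction with
  | mem x hx => obtain ⟨φ, rfl⟩ := hx; exact cls φ
  | zero => exact zero
  | add x y _ _ hx hy => exact add x y hx hy
  | neg x _ hx => exact neg x hx

/-- The weights `1` and `-1` of the two copies of a label. -/
def signWeight (b : Bool) : ℤ := if b then -1 else 1

/-- The weights `1` and `0` of the two copies of a label. -/
def firstWeight (b : Bool) : ℤ := if b then 0 else 1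

variable (ℓ) in
/-- An embedding of the target into `[ℓ] ⊔ ℝ` that preserves the first copies of the labels and
the order on the points. -/
def targetPoint (F : Finset ℚ) : Target ℓ F → Fin ℓ ⊕ ℝ
  | Sum.inl (i, false) => Sum.inl i
  | Sum.inl (i, true) => Sum.inr (-(i : ℕ))
  -- The exponential keeps the order and makes these points positive, away from the spare points `-i
  -- ≤ 0`.
  | Sum.inr q => Sum.inr (Real.exp (q.1 : ℝ))

theorem targetPoint_injective (F : Finset ℚ) : Function.Injective (targetPoint ℓ F) := by
  have h (i : ℕ) (q : ℚ) : -(i : ℝ) ≠ Real.exp (q : ℝ) := fun h => by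
    have := Real.exp_pos (q : ℝ)
    have : (0 : ℝ) ≤ i := Nat.cast_nonneg i
    linarith
  rintro (⟨i, _ | _⟩ | q) (⟨j, _ | _⟩ | q') <;>
    simp [targetPoint, Fin.val_inj, h, (h _ _).symm]

theorem coef_eq_of_forall {F : Finset ℚ} (C : Finset ℚ → ℤ) {X : Type} [Fintype X]
    (φ : X → Fin ℓ ⊕ ℝ) (g : X → Target ℓ F) (hg : ∀ s i, g s ≠ Sum.inl (i, true)) :
    coef C signWeight φ g = coef C firstWeight φ g := by
  have : ∀ s, labelWeight signWeight (g s) = labelWeight firstWeight (g s) := fun s => by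
    rcases h : g s with ⟨i, _ | _⟩ | q
    · rfl
    · exact absurd h (hg s i)
    · rfl
  simp only [coef, this]

theorem coef_firstWeight_eq_zero {F : Finset ℚ} (C : Finset ℚ → ℤ) {X : Type} [Fintype X]
    (φ : X → Fin ℓ ⊕ ℝ) {g : X → Target ℓ F} {s : X} {i : Fin ℓ} (hg : g s = Sum.inl (i, true)) :
    coef C firstWeight φ g = 0 := by
  unfold coef
  rw [Finset.prod_eq_zero (Finset.mem_univ s) (by rw [hg]; rfl), zero_mul, ite_self]

/-- Only the first copy of `i` maps to the label `i`, and `g` cannot use both copies since `φ` takes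
the value `i` at most once. -/
theorem Compat.missing {S : FI} {F : Finset ℚ} {φ : EmbSpace ℓ S}
    {g : S.carrier → Target ℓ F} (h : Compat φ.1 g) {s : S.carrier} {i : Fin ℓ}
    (hg : g s = Sum.inl (i, true)) (hinj : Function.Injective (targetPoint ℓ F ∘ g)) :
    (⟨targetPoint ℓ F ∘ g, hinj⟩ : EmbSpace ℓ S) ∈ missing ℓ S := by
  intro hsub
  obtain ⟨s', hs'⟩ := hsub ⟨i, rfl⟩
  have hs' : g s' = Sum.inl (i, false) := targetPoint_injective F hs'
  have label : ∀ t b, g t = Sum.inl (i, b) → φ.1 t = Sum.inl i := fun t b ht => by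
    rcases hφ : φ.1 t with j | r
    · obtain ⟨b', hb'⟩ := h.left t j hφ
      rw [ht, Sum.inl.injEq, Prod.mk.injEq] at hb'
      rw [hb'.1]
    · obtain ⟨q, hq⟩ := h.right t r hφ
      rw [ht] at hq
      cases hq
  have := φ.2 ((label s _ hg).trans (label s' _ hs').symm)
  subst this
  rw [hg] at hs'
  cases hs'

theorem Compat.sameType {F : Finset ℚ} {X : Type} {φ : X → Fin ℓ ⊕ ℝ} {g : X → Target ℓ F}
    (h : Compat φ g) (hg : ∀ s i, g s ≠ Sum.inl (i, true)) :
    SameType φ (targetPoint ℓ F ∘ g) where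
  left s i hi := by
    obtain ⟨b, hb⟩ := h.left s i hi
    cases b
    · simp [hb, targetPoint]
    · exact absurd hb (hg s i)
  right s r hr := by
    obtain ⟨q, hq⟩ := h.right s r hr
    exact ⟨Real.exp (q.1 : ℝ), by simp [hq, targetPoint]⟩
  mono s s' r r' x x' hr hr' hlt hx hx' := by
    obtain ⟨q, hq⟩ := h.right s r hr
    obtain ⟨q', hq'⟩ := h.right s' r' hr'
    have := h.mono s s' r r' q q' hr hr' hlt hq hq'
    simp only [Function.comp_apply, hq, hq', targetPoint, Sum.inr.injEq] at hx hx'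
    rw [← hx, ← hx']
    exact Real.exp_lt_exp.2 (by exact_mod_cast this)

/-- The terms of the sum that recovers the class of an embedding from its coefficients. -/
theorem coef_smul_xiClass {S : FI} [Fintype S.carrier] {F : Finset ℚ} (C : Finset ℚ → ℤ)
    (φ : EmbSpace ℓ S) (g : S.carrier → Target ℓ F)
    (hinj : Function.Injective (targetPoint ℓ F ∘ g)) :
    coef C signWeight φ.1 g • xiClass (⟨targetPoint ℓ F ∘ g, hinj⟩ : EmbSpace ℓ S) =
      coef C firstWeight φ.1 g • xiClass φ := by
  by_cases hc : Compat φ.1 g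
  swap
  · simp [coef, hc]
  by_cases hg : ∀ s i, g s ≠ Sum.inl (i, true)
  · rw [coef_eq_of_forall C φ.1 g hg, xiClass_eq_of_sameType (φ := φ)
      (ψ := ⟨targetPoint ℓ F ∘ g, hinj⟩) (hc.sameType hg)]
  · push Not at hg
    obtain ⟨s, i, hs⟩ := hg
    rw [coef_firstWeight_eq_zero C φ.1 hs, xiClass_eq_zero (hc.missing hs hinj), smul_zero,
      zero_smul]

open Classical in
/-- The coefficients of an embedding, set to zero if a label is missing from its image. -/
def xiCoef {F : Finset ℚ} (C : Finset ℚ → ℤ) {b : ℕ} (e : Target ℓ F ≃ Fin b) (n : ℕ)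
    (φ : EmbSpace ℓ (std n)) (g : std n ⟶ std b) : ℤ :=
  if φ ∈ missing ℓ (std n) then 0 else
    coef (X := Fin n) C signWeight φ.1 (fun s => e.symm ((show Fin n ↪ Fin b from g) s))

theorem SameType.missing_iff {S : FI} {φ ψ : EmbSpace ℓ S} (h : SameType φ.1 ψ.1) :
    φ ∈ missing ℓ S ↔ ψ ∈ missing ℓ S :=
  not_congr ⟨h.range_subset, (h.symm φ.2).range_subset⟩

theorem exists_xiCoef_hom {F : Finset ℚ} (C : Finset ℚ → ℤ) {b : ℕ} (e : Target ℓ F ≃ Fin b)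
    (n : ℕ) : ∃ c : (Xi ℓ).obj (Opposite.op (std n)) →+ ((std n ⟶ std b) → ℤ),
      ∀ φ, c (xiClass φ) = xiCoef C e n φ := by
  refine exists_pointClass_desc ((embPair ℓ).obj (Opposite.op (std n))) (xiCoef C e n)
    (fun φ ψ h => eq_of_joined (xiCoef C e n) (fun φ ψ h => ?_) h) fun φ => ?_
  · funext g
    classical exact if_congr h.missing_iff.symm rfl (SameType.coef_eq (X := Fin n) h φ.2 _ _ _).symm
  · funext g
    exact if_pos φ.2

theorem sum_hom_eq_sum_fun {A : Type*} [AddCommMonoid A] {W : Type} [Fintype W] {n b : ℕ}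
    (e : W ≃ Fin b) (T : (Fin n → W) → A) (hT : ∀ g, ¬ Function.Injective g → T g = 0) :
    ∑ g : std n ⟶ std b, T (fun s => e.symm ((show Fin n ↪ Fin b from g) s)) = ∑ g, T g := by
  refine Fintype.sum_of_injective
    (fun (g : std n ⟶ std b) s => e.symm ((show Fin n ↪ Fin b from g) s)) ?_ _ _ ?_ fun _ => rfl
  · intro g g' h
    refine DFunLike.ext (F := Fin n ↪ Fin b) g g' fun s => e.symm.injective (congrFun h s)
  · intro g hg
    refine hT g fun hinj => hg ⟨(⟨fun s => e (g s), e.injective.comp hinj⟩ : Fin n ↪ Fin b), ?_⟩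
    funext s
    exact e.symm_apply_apply _

theorem coef_eq_zero_of_not_injective {F : Finset ℚ} (C : Finset ℚ → ℤ) (wt : Bool → ℤ) {X : Type}
    [Fintype X] {φ : X → Fin ℓ ⊕ ℝ} (hφ : Function.Injective φ) {g : X → Target ℓ F}
    (hg : ¬ Function.Injective g) : coef C wt φ g = 0 :=
  if_neg fun h => hg (h.injective hφ)

open Classical in
-- A lost label contributes the factor `1 - 1 = 0`; if none is lost, all the deleted points are real
-- and contribute `1`.
theorem sum_coef_signWeight {C : Finset ℚ → ℤ} {k : ℕ} {F : Finset ℚ} (hgap : GapSum C k F)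
    {X Y : Type} [Fintype X] [Fintype Y] (hY : Fintype.card Y ≤ k) (f : X ↪ Y)
    {φ : Y → Fin ℓ ⊕ ℝ} (hφ : Function.Injective φ) (h : Set.range Sum.inl ⊆ Set.range φ)
    (g' : X → Target ℓ F) :
    ∑ g : Y → Target ℓ F, (if g ∘ f = g' then coef C signWeight φ g else 0) =
      if Set.range Sum.inl ⊆ Set.range (φ ∘ f) then coef C signWeight (φ ∘ f) g' else 0 := by
  refine (sum_coef_comp hgap signWeight hY f hφ g').trans ?_
  split_ifs with hf
  · rw [Finset.prod_eq_one, one_mul]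
    intro y _
    rcases hy : φ y with i | r
    · obtain ⟨x, hx⟩ := hf ⟨i, rfl⟩
      exact absurd ⟨x, hφ (hx.trans hy.symm)⟩ y.2
    · rfl
  · obtain ⟨_, ⟨i, rfl⟩, hi⟩ := Set.not_subset.1 hf
    obtain ⟨y, hy⟩ := h ⟨i, rfl⟩
    have hmem : y ∈ (Set.range f)ᶜ := by
      rintro ⟨x, rfl⟩
      exact hi ⟨x, hy⟩
    rw [Finset.prod_eq_zero (Finset.mem_univ ⟨y, hmem⟩) (by simp only [hy]; rfl), zero_mul]

theorem xiCoef_precomp {F : Finset ℚ} {C : Finset ℚ → ℤ} {k : ℕ} (hgap : GapSum C k F) {b : ℕ}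
    (e : Target ℓ F ≃ Fin b) {n m : ℕ} (hm : m ≤ k) (f : std n ⟶ std m)
    (φ : EmbSpace ℓ (std m)) (g' : std n ⟶ std b) :
    xiCoef C e n (precomp ℓ f φ) g' =
      ∑ g : std m ⟶ std b, open Classical in if f ≫ g = g' then xiCoef C e m φ g else 0 := by
  classical
  by_cases hφ : φ ∈ missing ℓ (std m)
  · simp [xiCoef, hφ, precomp_mem ℓ f φ hφ]
  have hrange : Set.range Sum.inl ⊆ Set.range φ.1 := not_not.1 hφ
  let f' : Fin n ↪ Fin m := f
  let g₁ : Fin n → Target ℓ F := fun s => e.symm ((show Fin n ↪ Fin b from g') s)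
  have key := sum_coef_signWeight hgap (X := Fin n) (Y := Fin m) (by simpa using hm) f' φ.2
    hrange g₁
  have hsum := sum_hom_eq_sum_fun (n := m) e
    (fun g => if g ∘ f' = g₁ then coef (X := Fin m) C signWeight φ.1 g else 0) fun g hg => by
      rw [coef_eq_zero_of_not_injective (X := Fin m) C signWeight φ.2 hg, ite_self]
  have hterm (g : std m ⟶ std b) : (if f ≫ g = g' then xiCoef C e m φ g else 0) =
      if (fun s => e.symm ((show Fin m ↪ Fin b from g) s)) ∘ f' = g₁ then
        coef (X := Fin m) C signWeight φ.1 (fun s => e.symm ((show Fin m ↪ Fin b from g) s))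
        else 0 := by
    refine if_congr ⟨fun h => ?_, fun h => ?_⟩ (if_neg hφ) rfl
    · subst h
      rfl
    · refine DFunLike.ext (F := Fin n ↪ Fin b) (f ≫ g) g' fun s => e.symm.injective ?_
      exact congrFun h s
  have hL : xiCoef C e n (precomp ℓ f φ) g' = if Set.range Sum.inl ⊆ Set.range (φ.1 ∘ f') then
      coef (X := Fin n) C signWeight (φ.1 ∘ f') g₁ else 0 := by
    unfold xiCoef
    by_cases h : precomp ℓ f φ ∈ missing ℓ (std n)
    · rw [if_pos h, if_neg]
      exact h
    · rw [if_neg h, if_pos]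
      · rfl
      · exact not_not.1 h
  rw [hL, Finset.sum_congr rfl fun g _ => hterm g]
  refine key.symm.trans (Eq.trans ?_ hsum.symm)
  congr!

/-- Restrict to the empty set: every point has total weight `1`, which leaves `C ∅`. -/
theorem sum_coef_firstWeight {F : Finset ℚ} {C : Finset ℚ → ℤ} {k : ℕ} (hgap : GapSum C k F)
    (h0 : C ∅ = 1) {n : ℕ} (hn : n ≤ k) {φ : Fin n → Fin ℓ ⊕ ℝ} (hφ : Function.Injective φ) :
    ∑ g : Fin n → Target ℓ F, coef C firstWeight φ g = 1 := by
  have key := sum_coef_comp hgap firstWeight (X := Empty) (Y := Fin n) (by simpa using hn)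
    ⟨Empty.elim, fun x => x.elim⟩ hφ Empty.elim
  have h1 : ∀ y, totalWeight firstWeight (φ y) = 1 := fun y => by
    rcases φ y with i | r <;> rfl
  have h2 : coef C firstWeight (φ ∘ Empty.elim) (Empty.elim : Empty → Target ℓ F) = 1 := by
    have : Compat (φ ∘ Empty.elim) (Empty.elim : Empty → Target ℓ F) :=
      ⟨fun s => s.elim, fun s => s.elim, fun s => s.elim⟩
    rw [coef, if_pos this]
    simpa [pointImage] using h0
  simp only [h1, Finset.prod_const_one, one_mul] at key
  refine Eq.trans ?_ (key.trans h2)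
  refine Eq.trans ?_ (Finset.sum_congr rfl fun g _ => (if_pos (Subsingleton.elim _ _)).symm)
  congr!

theorem xi_isFlat (ℓ : ℕ) : IsFlat.{u} (Xi ℓ) := by
  obtain ⟨C, hC0, hC⟩ := exists_gap_measure
  refine isFlat_of_retract _ fun k => ?_
  obtain ⟨F, hF⟩ := hC k
  have hgap : GapSum C k F := fun L U h1 h2 => by
    refine Eq.trans ?_ (hF L U h1 h2)
    congr!
  let e : Target ℓ F ≃ Fin (Fintype.card (Target ℓ F)) := Fintype.equivFin _
  choose c hc using exists_xiCoef_hom C e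
  -- The vector `v` is the class of the whole target embedded in `[ℓ] ⊔ ℝ`; its restrictions define
  -- the retraction, and `c` is the section.
  refine ⟨_, xiClass ⟨targetPoint ℓ F ∘ e.symm,
    (targetPoint_injective F).comp e.symm.injective⟩, c, fun n m f x g' hm => ?_, fun n hn x => ?_⟩
  · classical
    induction x using xi_induction with
    | cls φ =>
      rw [xi_map_xiClass]
      simp only [hc]
      exact xiCoef_precomp hgap e hm f φ g'
    | zero => simp
    | add x y hx hy =>
      simp only [map_add, Pi.add_apply, hx, hy, ← Finset.sum_add_distrib]
      exact Finset.sum_congr rfl fun g _ => by split_ifs <;> simp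
    | neg x hx =>
      simp only [map_neg, Pi.neg_apply, hx, ← Finset.sum_neg_distrib]
      exact Finset.sum_congr rfl fun g _ => by split_ifs <;> simp
  · induction x using xi_induction with
    | cls φ =>
      simp only [hc, xi_map_xiClass]
      by_cases hφ : φ ∈ missing ℓ (std n)
      · simp only [xiCoef, hφ, if_true, zero_smul, Finset.sum_const_zero, xiClass_eq_zero hφ]
      have hterm : ∀ g : std n ⟶ std (Fintype.card (Target ℓ F)),
          xiCoef C e n φ g • xiClass (precomp ℓ g ⟨targetPoint ℓ F ∘ e.symm,
            (targetPoint_injective F).comp e.symm.injective⟩) =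
          coef (X := Fin n) C firstWeight φ.1 (fun s => e.symm
            ((show Fin n ↪ Fin (Fintype.card (Target ℓ F)) from g) s)) • xiClass φ := fun g => by
        rw [xiCoef, if_neg hφ]
        let : Fintype (std n).carrier := inferInstanceAs (Fintype (Fin n))
        exact coef_smul_xiClass C φ _ _
      rw [Finset.sum_congr rfl fun g _ => hterm g, ← Finset.sum_smul]
      rw [sum_hom_eq_sum_fun e (fun g => coef (X := Fin n) C firstWeight φ.1 g) fun g hg =>
        coef_eq_zero_of_not_injective (X := Fin n) C firstWeight φ.2 hg]
      have := sum_coef_firstWeight hgap hC0 hn φ.2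
      rw [this, one_smul]
    | zero => simp
    | add x y hx hy =>
      simp only [map_add, Pi.add_apply, add_smul, Finset.sum_add_distrib, hx, hy]
    | neg x hx => simp only [map_neg, Pi.neg_apply, neg_smul, Finset.sum_neg_distrib, hx]

end XiFlat

end FI

end

theorem mainTheorem8 (ℓ : ℕ) : FI.IsFlat.{u} (FI.Xi ℓ) := by
  exact FI.xi_isFlat ℓ
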